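/- **Uniform tail-ends estimates.** Let $n\in\mathbb N$, $\alpha\in(0,1)$, $H=L^2(\mathbb R^n)$ with inner product $(\cdot,\cdot)$, and let $V=H^\alpha(\mathbb R^n)$ be the space of $u\in H$ with $\iint \frac{|u(x)-u(y)|^2}{|x-y|^{n+2\alpha}}\,dx\,dy<\infty$, with $\|u\|_V^2=\|u\|_H^2+\tfrac12C(n,\alpha)\iint \frac{|u(x)-u(y)|^2}{|x-y|^{n+2\alpha}}\,dx\,dy$, where $C(n,\alpha)=\frac{\alpha4^\alpha\Gamma(\frac{n+2\alpha}{2})}{\pi^{n/2}\Gamma(1-\alpha)}$. For $u,\xi\in V$ put $$((-\Delta)^{\alpha/2}u,(-\Delta)^{\alpha/2}\xi)=\tfrac12C(n,\alpha)\iint \frac{(u(x)-u(y))(\xi(x)-\xi(y))}{|x-y|^{n+2\alpha}}\,dx\,dy .$$ *Assumptions.* (i) Let $p>2$, $\lambda_1,\lambda_2>0$, $\psi_1\in L^1_{loc}(\mathbb R;L^1(\mathbb R^n))$ and $\psi_2,\psi_3\in L^\infty_{loc}(\mathbb R;L^\infty(\mathbb R^n))\cap L^1_{loc}(\mathbb R;L^1(\mathbb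 R^n))$. The function $F:\mathbb R\times\mathbb R^n\times\mathbb R\to\mathbb R$ is continuous, differentiable in its third argument, and for all $t,u,u_1,u_2\in\mathbb R$ and $x\in\mathbb R^n$: $F(t,x,0)=0$; $F(t,x,u)u\ge\lambda_1|u|^p-\psi_1(t,x)$; $|F(t,x,u_1)-F(t,x,u_2)|\le\lambda_2(\psi_2(t,x)+|u_1|^{p-2}+|u_2|^{p-2})|u_1-u_2|$; $\frac{\partial F}{\partial u}(t,x,u)\ge-\psi_3(t,x)$. (ii) $g\in L^2_{loc}(\mathbb R;H)$. (iii) $\sigma(t,x,s)=\sigma_1(t,x)+\kappa(x)\sigma_2(t,x,s)\in l^2$, where $\kappa\in L^2(\mathbb R^n)\cap L^\infty(\mathbb R^n)$, $\sigma_1:\mathbb R\to L^2(\mathbb R^n;l^2)$ is continuous, and the components of $\sigma_2=\{\sigma_{2,k}\}_{k\ge1}$ are measurable in $(t,x)$ and satisfy, for all $t,x,s,s_1,s_2$, $|\sigma_{2,k}(t,x,s_1)-\sigma_{2,k}(t,x,s_2)|\le\alpha_k|s_1-s_2|$ and $|\sigma_{2,k}(t,x,s)|\le\beta_k+\gamma_k|s|$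 with positive numbers $\alpha_k,\beta_k,\gamma_k$ such that $\sum_k(\alpha_k^2+\beta_k^2+\gamma_k^2)<\infty$. For $u\in H$ and $w\in l^2$ put $(\sigma(t,u)w)(x)=\sum_k\bigl(\sigma_{1,k}(t,x)+\kappa(x)\sigma_{2,k}(t,x,u(x))\bigr)w_k$. For $T>0$, $u_0\in H$ and a control $v\in L^2(0,T;l^2)$, a solution of the controlled equation $$\frac{du_v}{dt}+(-\Delta)^\alpha u_v+F(t,\cdot,u_v)=g(t)+\sigma(t,u_v)v(t),\qquad u_v(0)=u_0,$$ is a function $u_v\in C([0,T],H)\cap L^2(0,T;V)\cap L^p(0,T;L^p(\mathbb R^n))$ with $u_v(0)=u_0$ such that for all $t\in[0,T]$ and all $\xi\in V\cap L^p(\mathbb R^n)$ $$(u_v(t),\xi)+\int_0^t((-\Delta)^{\alpha/2}u_v(s),(-\Delta)^{\alpha/2}\xi)\,ds+\int_0^t\!\int_{\mathbb R^n}F(s,x,u_v(s,x))\xi(x)\,dx\,ds=(u_0,\xi)+\int_0^t(g(s),\xi)\,ds+\int_0^t(\sigma(s,u_v(s))v(s),\xi)\,ds .$$ *Claim.* Under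 (i)–(iii), let $T>0$ and $u_0\in H$. Then for every $R>0$ and $\varepsilon>0$ there exists $K=K(T,u_0,R,\varepsilon)>0$ such that for every $v\in L^2(0,T;l^2)$ with $\|v\|_{L^2(0,T;l^2)}\le R$, every solution $u_v$ of the controlled equation with initial value $u_0$ satisfies $$\int_{|x|\ge m}|u_v(t,x)|^2\,dx<\varepsilon\qquad\text{for all real } m\ge K\text{ and all } t\in[0,T].$$ -/

import Mathlib

open MeasureTheory Set
open scoped ENNReal

noncomputable section

namespace FracControl

/-- Euclidean space `ℝⁿ`. -/
abbrev Rn (n : ℕ) : Type := EuclideanSpace ℝ (Fin n)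

/-- `H = L²(ℝⁿ)`, real valued. -/
abbrev H (n : ℕ) : Type := Lp ℝ 2 (volume : Measure (Rn n))

/-- `l²`, the Hilbert space of square summable real sequences. -/
abbrev Ell2 : Type := lp (fun _ : ℕ => ℝ) 2

/-- The space `L²(0,T; l²)` of controls. -/
abbrev Control (T : ℝ) : Type := Lp Ell2 2 (volume.restrict (Ioc (0 : ℝ) T))

/-- The normalising constant `C(n,α) = α 4^α Γ((n+2α)/2) / (π^{n/2} Γ(1-α))` of the fractional
Laplacian. -/
def fracConst (n : ℕ) (α : ℝ) : ℝ :=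
  α * (4 : ℝ) ^ α * Real.Gamma (((n : ℝ) + 2 * α) / 2)
    / (Real.pi ^ ((n : ℝ) / 2) * Real.Gamma (1 - α))

/-- The squared norm of `V = H^α(ℝⁿ)`, with value `∞` exactly when the `L²` function `u` is not
in `V`:
`∫ |u|² dx + (1/2) C(n,α) ∬ |u(x) - u(y)|² / |x-y|^{n+2α} dx dy`. -/
def sobolevNormSq {n : ℕ} (α : ℝ) (u : H n) : ℝ≥0∞ :=
  (∫⁻ x, ENNReal.ofReal (u x ^ 2))
    + ENNReal.ofReal (fracConst n α / 2) *
      ∫⁻ z : Rn n × Rn n,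
        ENNReal.ofReal ((u z.1 - u z.2) ^ 2 / ‖z.1 - z.2‖ ^ ((n : ℝ) + 2 * α))

/-- `u ∈ V = H^α(ℝⁿ)`. -/
def MemSobolev {n : ℕ} (α : ℝ) (u : H n) : Prop := sobolevNormSq α u < ∞

/-- The bilinear form of `(-Δ)^α` on `V`, that is, the part
`(1/2) C(n,α) ∬ (u(x) - u(y)) (w(x) - w(y)) / |x-y|^{n+2α} dx dy`
of the inner product of `V`, also written `((-Δ)^{α/2} u, (-Δ)^{α/2} w)`.
For `u, w ∈ V` the double integral converges absolutely. -/
def fracForm {n : ℕ} (α : ℝ) (u w : H n) : ℝ :=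
  fracConst n α / 2 *
    ∫ z : Rn n × Rn n,
      (u z.1 - u z.2) * (w z.1 - w z.2) / ‖z.1 - z.2‖ ^ ((n : ℝ) + 2 * α)

/-- The hypotheses on the drift `F(t,x,u)`, with exponent `p`, constants `lam₁, lam₂` and
coefficients `ψ₁ ∈ L¹_loc(ℝ; L¹(ℝⁿ))` and
`ψ₂, ψ₃ ∈ L^∞_loc(ℝ; L^∞(ℝⁿ)) ∩ L¹_loc(ℝ; L¹(ℝⁿ))`. -/
structure DriftCondition {n : ℕ} (p lam₁ lam₂ : ℝ) (F : ℝ → Rn n → ℝ → ℝ)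
    (ψ₁ ψ₂ ψ₃ : ℝ → Rn n → ℝ) : Prop where
  two_lt : 2 < p
  lam₁_pos : 0 < lam₁
  lam₂_pos : 0 < lam₂
  cont : Continuous fun q : ℝ × Rn n × ℝ => F q.1 q.2.1 q.2.2
  psi₁_L1 : ∀ a b : ℝ, IntegrableOn (fun q : ℝ × Rn n => ψ₁ q.1 q.2) (Icc a b ×ˢ univ)
  psi₂_L1 : ∀ a b : ℝ, IntegrableOn (fun q : ℝ × Rn n => ψ₂ q.1 q.2) (Icc a b ×ˢ univ)
  psi₃_L1 : ∀ a b : ℝ, IntegrableOn (fun q : ℝ × Rn n => ψ₃ q.1 q.2) (Icc a b ×ˢ univ)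
  psi₂_Linf : ∀ a b : ℝ, MemLp (fun q : ℝ × Rn n => ψ₂ q.1 q.2) ∞
    (volume.restrict (Icc a b ×ˢ univ))
  psi₃_Linf : ∀ a b : ℝ, MemLp (fun q : ℝ × Rn n => ψ₃ q.1 q.2) ∞
    (volume.restrict (Icc a b ×ˢ univ))
  zero : ∀ t x, F t x 0 = 0
  coercive : ∀ t x u, lam₁ * |u| ^ p - ψ₁ t x ≤ F t x u * u
  lipschitz : ∀ t x u₁ u₂, |F t x u₁ - F t x u₂|
    ≤ lam₂ * (ψ₂ t x + |u₁| ^ (p - 2) + |u₂| ^ (p - 2)) * |u₁ - u₂|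
  differentiable : ∀ t x, Differentiable ℝ fun u => F t x u
  deriv_ge : ∀ t x u, -ψ₃ t x ≤ deriv (fun r => F t x r) u

/-- The hypotheses on the diffusion coefficient
`σ(t,x,s) = σ₁(t,x) + κ(x) σ₂(t,x,s) ∈ l²`: `κ ∈ L²(ℝⁿ) ∩ L^∞(ℝⁿ)`, `σ₁ : ℝ → L²(ℝⁿ; l²)` is
continuous, and the components `σ₂ₖ` of `σ₂` are Lipschitz and of linear growth in `s`, with
constants that are square summable in `k`. -/
structure DiffusionCondition {n : ℕ} (κ : Rn n → ℝ)
    (σ₁ : ℝ → Lp Ell2 2 (volume : Measure (Rn n)))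
    (σ₂ : ℕ → ℝ → Rn n → ℝ → ℝ) (a b c : ℕ → ℝ) : Prop where
  kappa_L2 : MemLp κ 2 volume
  kappa_Linf : MemLp κ ∞ volume
  sigma₁_cont : Continuous σ₁
  sigma₂_meas : ∀ k s, Measurable fun q : ℝ × Rn n => σ₂ k q.1 q.2 s
  a_pos : ∀ k, 0 < a k
  b_pos : ∀ k, 0 < b k
  c_pos : ∀ k, 0 < c k
  sigma₂_lip : ∀ k t x s₁ s₂, |σ₂ k t x s₁ - σ₂ k t x s₂| ≤ a k * |s₁ - s₂|
  sigma₂_growth : ∀ k t x s, |σ₂ k t x s| ≤ b k + c k * |s|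
  summable : Summable fun k => a k ^ 2 + b k ^ 2 + c k ^ 2

/-- The function `σ(t,u)(w)` on `ℝⁿ`, for `u ∈ H` and `w ∈ l²`:
`x ↦ ∑ₖ (σ₁ₖ(t,x) + κ(x) σ₂ₖ(t,x,u(x))) wₖ`. -/
def sigmaOp {n : ℕ} (κ : Rn n → ℝ) (σ₁ : ℝ → Lp Ell2 2 (volume : Measure (Rn n)))
    (σ₂ : ℕ → ℝ → Rn n → ℝ → ℝ) (t : ℝ) (u : H n) (w : Ell2) (x : Rn n) : ℝ :=
  ∑' k : ℕ, (σ₁ t x k + κ x * σ₂ k t x (u x)) * w k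

/-- `u` is a solution on `[0,T]` of the controlled equation
`du/dt + (-Δ)^α u + F(t,·,u) = g(t) + σ(t,u) v(t)`, `u(0) = u₀`:
`u ∈ C([0,T],H) ∩ L²(0,T;V) ∩ L^p(0,T;L^p(ℝⁿ))` and the equation holds in integrated form against
every `ξ ∈ V ∩ L^p(ℝⁿ)`. Only the values of `u` on `[0,T]` matter. -/
structure IsSolution {n : ℕ} (α p T : ℝ) (F : ℝ → Rn n → ℝ → ℝ) (g : ℝ → H n)
    (κ : Rn n → ℝ) (σ₁ : ℝ → Lp Ell2 2 (volume : Measure (Rn n)))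
    (σ₂ : ℕ → ℝ → Rn n → ℝ → ℝ) (u₀ : H n) (v : Control T) (u : ℝ → H n) : Prop where
  continuousOn : ContinuousOn u (Icc 0 T)
  meas_V : AEMeasurable (fun s => sobolevNormSq α (u s)) (volume.restrict (Icc 0 T))
  mem_L2V : ∫⁻ s in Icc 0 T, sobolevNormSq α (u s) < ∞
  meas_Lp : AEMeasurable (fun s => eLpNorm (u s) (ENNReal.ofReal p) volume)
    (volume.restrict (Icc 0 T))
  mem_LpLp : ∫⁻ s in Icc 0 T, eLpNorm (u s) (ENNReal.ofReal p) volume ^ p < ∞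
  initial : u 0 = u₀
  weak : ∀ t ∈ Icc 0 T, ∀ ξ : H n, MemSobolev α ξ → MemLp ξ (ENNReal.ofReal p) volume →
    inner ℝ (u t) ξ + (∫ s in (0 : ℝ)..t, fracForm α (u s) ξ)
        + (∫ s in (0 : ℝ)..t, ∫ x, F s x (u s x) * ξ x)
      = inner ℝ u₀ ξ + (∫ s in (0 : ℝ)..t, inner ℝ (g s) ξ)
        + ∫ s in (0 : ℝ)..t, ∫ x, sigmaOp κ σ₁ σ₂ s (u s) (v s) x * ξ x

end FracControl

end

set_option linter.unusedSectionVars false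

namespace FracControl

open Filter Topology

/-! ### Time translations in `L^q` and kernels continuous at the diagonal. -/

section Translation

variable {Y : Type*} [NormedAddCommGroup Y] [NormedSpace ℝ Y] [FiniteDimensional ℝ Y]
  [MeasureSpace Y] [BorelSpace Y] [(volume : Measure Y).IsAddHaarMeasure]

/-! The proof is a weighted energy estimate. The equation is tested with `η u`, where `η(x) = min(1,
|x|/(k+1))` equals 1 for `|x| ≥ k+1` and tends to 0 pointwise as `k → ∞`. Coercivity of `F` and
Young's inequality bound the growth of `E(t) = ∫ η u(t)²` by the integral of `η` against an
integrable density independent of `u` and `v`, plus the integral of `(1 + Γ² + 2‖v‖²) E`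
(`weighted_energy_inequality`).

The nonlocal term is `∬ Du · D(ηu)` with `D = gag α`. Since `D(ηu) = η Du + u Dη`, it is nonnegative
up to the commutator `u Dη`, whose squared `L²` norm is at most `kernelMass n α L · ‖u‖²` when `η`
is `L`-Lipschitz, and this mass tends to 0 along `L = 1/(k+1)` (`IsWeight.lintegral_commutator_le`,
`tendsto_kernelMass`). The same inequality with weight 1 bounds `sup ‖u‖` and `∫∬ |Du|²` in terms of
the data and `R` only, so the commutator error is uniformly small. Grönwall's inequality, whose
constant sees `v` only through `R`, then bounds `E(t)` by the weighted data plus this error. The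
weighted data vanish as `k → ∞` by dominated convergence.

The delicate point is to justify testing with `η u`. No chain rule in a dual space is used. Taking
`ξ = η u(s)` for almost every fixed `s` gives `E(s') - E(s) = ∫_s^{s'} (P(r,s') + P(r,s)) dr`, where
`P(r,s)` pairs the right-hand side at time `r` with `η u(s)`. With `s' = s + h`, integrating in `s`
and dividing by `h`, the left side telescopes, while the right side tends to `2 ∫ P(s,s) ds` because
time translation is continuous in `L^q`, `q < ∞` (`diagContinuous_pairing`,
`energy_identity_of_increments`). This requires jointly measurable representatives
(`exists_joint_representative`) and a splitting of the drift into an `L²` part, where `|u| ≤ 1`, and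
a part in the dual of `L^p`, where `|u| > 1`. -/

theorem measurePreserving_timeShift (ρ : ℝ) :
    MeasurePreserving (fun z : ℝ × Y => (z.1 + ρ, z.2)) volume volume :=
  (measurePreserving_add_right volume ρ).prod (MeasurePreserving.id volume)

/-- Translation in the time variable is continuous in `L^q`. -/
theorem tendsto_eLpNorm_timeShift {q : ℝ≥0∞} (hq1 : 1 ≤ q) (hq : q ≠ ∞) {f : ℝ × Y → ℝ}
    (hf : MemLp f q volume) :
    Tendsto (fun ρ : ℝ => eLpNorm (fun z : ℝ × Y => f (z.1 + ρ, z.2) - f z) q volume)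
      (𝓝 0) (𝓝 0) := by
  have : Fact (1 ≤ q) := ⟨hq1⟩
  let g : ℝ → C(ℝ × Y, ℝ × Y) := fun ρ => ⟨fun z => (z.1 + ρ, z.2), by fun_prop⟩
  have hg : Continuous g := by
    refine ContinuousMap.continuous_of_continuous_uncurry _ ?_
    change Continuous fun z : ℝ × (ℝ × Y) => ((z.2.1 + z.1, z.2.2) : ℝ × Y)
    fun_prop
  have hgm : ∀ ρ, MeasurePreserving (g ρ) volume volume := fun ρ => measurePreserving_timeShift ρ
  -- Composition with a continuous family of measure preserving maps is continuous in `L^q` for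
  -- finite `q`; the claim is this continuity at `ρ = 0`, where the shift is the identity.
  have key : Continuous fun ρ : ℝ => Lp.compMeasurePreserving (g ρ) (hgm ρ) (hf.toLp f) :=
    Continuous.compMeasurePreservingLp continuous_const hg hgm hq
  have h0 := (tendsto_iff_edist_tendsto_0.1 (key.tendsto 0))
  refine h0.congr fun ρ => ?_
  rw [Lp.edist_def]
  refine eLpNorm_congr_ae ?_
  have e1 := Lp.coeFn_compMeasurePreserving (hf.toLp f) (hgm ρ)
  have e2 := Lp.coeFn_compMeasurePreserving (hf.toLp f) (hgm 0)
  have e3 := (hgm ρ).quasiMeasurePreserving.ae_eq_comp hf.coeFn_toLp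
  have e4 := (hgm 0).quasiMeasurePreserving.ae_eq_comp hf.coeFn_toLp
  filter_upwards [e1, e2, e3, e4] with z h1 h2 h3 h4
  simp only [Pi.sub_apply]
  rw [h1, h2, h3, h4]
  simp [g]

end Translation

/-- A kernel on `(0,T]²` that is continuous at the diagonal in the mean, with respect to shifts of
the first variable. -/
structure DiagContinuous (T : ℝ) (P : ℝ → ℝ → ℝ) : Prop where
  integrable : IntegrableOn (fun z : ℝ × ℝ => P z.1 z.2) (Ioc 0 T ×ˢ Ioc 0 T)
  shift : ∀ ρ, Integrable fun s => P (s + ρ) s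
  near : ∀ ε > 0, ∃ δ > 0, ∀ ρ, |ρ| < δ → ∀ S, MeasurableSet S →
    |∫ s in S, (P (s + ρ) s - P s s)| ≤ ε

theorem DiagContinuous.diag {T : ℝ} {P : ℝ → ℝ → ℝ} (h : DiagContinuous T P) :
    Integrable fun s => P s s := by simpa using h.shift 0

theorem DiagContinuous.add {T : ℝ} {P Q : ℝ → ℝ → ℝ} (hP : DiagContinuous T P)
    (hQ : DiagContinuous T Q) : DiagContinuous T fun r s => P r s + Q r s where
  integrable := hP.integrable.add hQ.integrable
  shift ρ := (hP.shift ρ).add (hQ.shift ρ)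
  near ε hε := by
    obtain ⟨δ, hδ, h1⟩ := hP.near (ε / 2) (half_pos hε)
    obtain ⟨δ', hδ', h2⟩ := hQ.near (ε / 2) (half_pos hε)
    refine ⟨min δ δ', lt_min hδ hδ', fun ρ hρ S hS => ?_⟩
    have a1 := h1 ρ (hρ.trans_le (min_le_left _ _)) S hS
    have a2 := h2 ρ (hρ.trans_le (min_le_right _ _)) S hS
    have : ∫ s in S, (P (s + ρ) s + Q (s + ρ) s - (P s s + Q s s))
        = (∫ s in S, (P (s + ρ) s - P s s)) + ∫ s in S, (Q (s + ρ) s - Q s s) := by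
      rw [← integral_add]
      · congr 1; ext s; ring
      · exact ((hP.shift ρ).sub hP.diag).integrableOn
      · exact ((hQ.shift ρ).sub hQ.diag).integrableOn
    rw [this]
    exact (abs_add_le _ _).trans (by linarith)

theorem DiagContinuous.const_mul {T : ℝ} {P : ℝ → ℝ → ℝ} (hP : DiagContinuous T P) (c : ℝ) :
    DiagContinuous T fun r s => c * P r s where
  integrable := hP.integrable.const_mul c
  shift ρ := (hP.shift ρ).const_mul c
  near ε hε := by
    -- The `+ 1` covers `c = 0`.
    obtain ⟨δ, hδ, h1⟩ := hP.near (ε / (|c| + 1)) (by positivity)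
    refine ⟨δ, hδ, fun ρ hρ S hS => ?_⟩
    have a1 := h1 ρ hρ S hS
    simp_rw [← mul_sub]
    rw [integral_const_mul, abs_mul]
    have hc : 0 ≤ |c| := abs_nonneg c
    rw [le_div_iff₀ (by positivity)] at a1
    nlinarith [abs_nonneg (∫ s in S, (P (s + ρ) s - P s s))]

/-! ### Hölder pairings as diagonally continuous kernels. -/

section Pairing

variable {Y : Type*} [NormedAddCommGroup Y] [NormedSpace ℝ Y] [FiniteDimensional ℝ Y]
  [MeasureSpace Y] [BorelSpace Y] [(volume : Measure Y).IsAddHaarMeasure]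

/-- Each factor ignores one of the two time variables, so it stays in its Lebesgue space only
because that variable is confined to a set of finite measure; Hölder's inequality then applies on
the triple product. -/
theorem integrable_tensor_pairing {p q : ℝ≥0∞} [ENNReal.HolderConjugate q p] {f w : ℝ × Y → ℝ}
    (hf : MemLp f q volume) (hw : MemLp w p volume) (T : ℝ) :
    Integrable (fun z : (ℝ × ℝ) × Y => f (z.1.1, z.2) * w (z.1.2, z.2))
      ((volume.restrict (Ioc 0 T ×ˢ Ioc 0 T)).prod volume) := by
  set μ : Measure ℝ := volume.restrict (Ioc 0 T) with hμ
  have hprod : (volume : Measure (ℝ × ℝ)).restrict (Ioc 0 T ×ˢ Ioc 0 T) = μ.prod μ := by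
    rw [hμ, Measure.prod_restrict]; rfl
  rw [hprod]
  have gen : ∀ {r : ℝ≥0∞} {h : ℝ × Y → ℝ}, MemLp h r volume →
      MemLp (fun z : (ℝ × ℝ) × Y => h (z.1.2, z.2)) r ((μ.prod μ).prod volume) := by
    intro r h hh
    have h1 : MemLp h r (μ.prod volume) := by
      refine hh.mono_measure ?_
      exact Measure.prod_mono Measure.restrict_le_self le_rfl
    have h2 := MemLp.comp_snd h1 μ
    exact h2.comp_measurePreserving (measurePreserving_prodAssoc μ μ volume)
  have h3 : MemLp (fun z : (ℝ × ℝ) × Y => f (z.1.1, z.2)) q ((μ.prod μ).prod volume) := by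
    have := (gen hf).comp_measurePreserving
      ((Measure.measurePreserving_swap (μ := μ) (ν := μ)).prod (MeasurePreserving.id volume))
    exact this
  exact h3.integrable_mul (gen hw)

/-- The pairing `∫ f(r,y) w(s,y) dy` is continuous at the diagonal in the mean. -/
theorem diagContinuous_pairing {p q : ℝ≥0∞} [hpq : ENNReal.HolderConjugate q p]
    (hq : q ≠ ∞) {f w : ℝ × Y → ℝ}
    (hf : MemLp f q volume) (hw : MemLp w p volume) (T : ℝ) :
    DiagContinuous T fun r s => ∫ y, f (r, y) * w (s, y) := by
  have hq1 : 1 ≤ q := ENNReal.HolderConjugate.one_le q p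
  have hfs : ∀ ρ : ℝ, MemLp (fun z : ℝ × Y => f (z.1 + ρ, z.2)) q volume := fun ρ =>
    hf.comp_measurePreserving (measurePreserving_timeShift ρ)
  have hi : ∀ ρ : ℝ, Integrable (fun z : ℝ × Y => f (z.1 + ρ, z.2) * w z) (volume.prod volume) :=
    fun ρ => (hfs ρ).integrable_mul hw
  have hsh : ∀ ρ : ℝ, Integrable fun s : ℝ => ∫ y, f (s + ρ, y) * w (s, y) := fun ρ =>
    (hi ρ).integral_prod_left
  refine ⟨(integrable_tensor_pairing hf hw T).integral_prod_left, hsh, fun ε hε => ?_⟩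
  have ht := tendsto_eLpNorm_timeShift hq1 hq hf
  have ht2 : Tendsto (fun ρ : ℝ =>
      (eLpNorm (fun z : ℝ × Y => f (z.1 + ρ, z.2) - f z) q volume * eLpNorm w p volume).toReal)
      (𝓝 0) (𝓝 0) := by
    have hm := ENNReal.Tendsto.mul_const ht (Or.inr hw.2.ne)
    rw [zero_mul] at hm
    have hm' := (ENNReal.tendsto_toReal ENNReal.zero_ne_top).comp hm
    rwa [ENNReal.toReal_zero] at hm'
  obtain ⟨δ, hδ, h⟩ := Metric.eventually_nhds_iff.1 (ht2.eventually (gt_mem_nhds hε))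
  refine ⟨δ, hδ, fun ρ hρ S hS => ?_⟩
  have hb := h (y := ρ) (by simpa using hρ)
  have h0 := hi 0
  simp only [add_zero] at h0
  have e1 : ∀ᵐ s : ℝ, (∫ y, f (s + ρ, y) * w (s, y)) - (∫ y, f (s, y) * w (s, y))
      = ∫ y, (f (s + ρ, y) - f (s, y)) * w (s, y) := by
    filter_upwards [(hi ρ).prod_right_ae, h0.prod_right_ae] with s a1 a2
    rw [← integral_sub a1 a2]
    congr 1; ext y; ring
  rw [integral_congr_ae (ae_restrict_of_ae e1)]
  have hd : MemLp (fun z : ℝ × Y => f (z.1 + ρ, z.2) - f z) q volume := (hfs ρ).sub hf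
  have hdi : Integrable (fun z : ℝ × Y => (f (z.1 + ρ, z.2) - f z) * w z)
      (volume.prod volume) := hd.integrable_mul hw
  -- Enlarging `S` to the whole line makes the bound independent of `S`; Hölder then leaves `‖f(· +
  -- ρ) - f‖_q ‖w‖_p`, which is small for small `ρ`.
  have h1 : |∫ s in S, ∫ y, (f (s + ρ, y) - f (s, y)) * w (s, y)|
      ≤ ∫ z : ℝ × Y, ‖(f (z.1 + ρ, z.2) - f z) * w z‖ ∂(volume.prod volume) := by
    calc |∫ s in S, ∫ y, (f (s + ρ, y) - f (s, y)) * w (s, y)|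
        ≤ ∫ s in S, |∫ y, (f (s + ρ, y) - f (s, y)) * w (s, y)| := abs_integral_le_integral_abs
      _ ≤ ∫ s, |∫ y, (f (s + ρ, y) - f (s, y)) * w (s, y)| :=
          setIntegral_le_integral hdi.integral_prod_left.abs (ae_of_all _ fun _ => abs_nonneg _)
      _ ≤ ∫ s, ∫ y, ‖(f (s + ρ, y) - f (s, y)) * w (s, y)‖ := by
          refine integral_mono hdi.integral_prod_left.abs hdi.norm.integral_prod_left fun s => ?_
          exact abs_integral_le_integral_abs
      _ = _ := (integral_prod _ hdi.norm).symm
  refine h1.trans ?_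
  rw [integral_norm_eq_lintegral_enorm hdi.1, ← eLpNorm_one_eq_lintegral_enorm]
  refine le_trans (ENNReal.toReal_mono (ENNReal.mul_ne_top hd.2.ne hw.2.ne) ?_)
    (le_of_lt (lt_of_abs_lt (by simpa using hb)))
  rw [← Measure.volume_eq_prod]
  have hH := eLpNorm_smul_le_mul_eLpNorm (p := q) (q := p) (r := 1) hw.1 hd.1
  rwa [smul_eq_mul] at hH

end Pairing

/-! ### Integral Grönwall inequality with an integrable coefficient -/

/-- Serves to make `exp(-∫ A)` absolutely continuous: `exp` is 1-Lipschitz on the nonpositive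
half-line. -/
theorem absolutelyContinuousOnInterval_lipschitz_comp {f φ : ℝ → ℝ} {a b : ℝ} {K : NNReal}
    {s : Set ℝ} (hφ : LipschitzOnWith K φ s) (hf : AbsolutelyContinuousOnInterval f a b)
    (hs : ∀ x ∈ uIcc a b, f x ∈ s) :
    AbsolutelyContinuousOnInterval (fun x => φ (f x)) a b := by
  rw [absolutelyContinuousOnInterval_iff] at hf ⊢
  intro ε hε
  obtain ⟨δ, hδ, h⟩ := hf (ε / (K + 1)) (by positivity)
  refine ⟨δ, hδ, fun E hE hlt => ?_⟩
  have h1 := h E hE hlt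
  have hle : ∑ i ∈ Finset.range E.1, dist (φ (f (E.2 i).1)) (φ (f (E.2 i).2))
      ≤ K * ∑ i ∈ Finset.range E.1, dist (f (E.2 i).1) (f (E.2 i).2) := by
    rw [Finset.mul_sum]
    refine Finset.sum_le_sum fun i hi => ?_
    have := hE.1 i hi
    exact hφ.dist_le_mul _ (hs _ this.1) _ (hs _ this.2)
  refine hle.trans_lt ?_
  rw [lt_div_iff₀ (by positivity)] at h1
  have : 0 ≤ ∑ i ∈ Finset.range E.1, dist (f (E.2 i).1) (f (E.2 i).2) :=
    Finset.sum_nonneg fun _ _ => dist_nonneg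
  nlinarith

/-- The function `(D + ∫ A E) exp(-∫ A)` is absolutely continuous, and its derivative `A exp(-∫ A)
(E - D - ∫ A E)` is nonpositive almost everywhere. The fundamental theorem of calculus for
absolutely continuous functions then suffices, so `A` need only be integrable, as is the case for
`‖v‖²`. -/
theorem gronwall_integral {E A : ℝ → ℝ} {T D : ℝ} (hT : 0 ≤ T)
    (hE : ContinuousOn E (Icc 0 T)) (hA : IntervalIntegrable A volume 0 T)
    (hA0 : ∀ s, 0 ≤ A s)
    (h : ∀ t ∈ Icc 0 T, E t ≤ D + ∫ s in (0 : ℝ)..t, A s * E s) :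
    E T ≤ D * Real.exp (∫ s in (0 : ℝ)..T, A s) := by
  have hu : uIcc 0 T = Icc 0 T := uIcc_of_le hT
  have h0 : (0 : ℝ) ∈ uIcc 0 T := by simp
  have hAE : IntervalIntegrable (fun s => A s * E s) volume 0 T :=
    hA.mul_continuousOn (by rwa [hu])
  set B : ℝ → ℝ := fun t => ∫ s in (0 : ℝ)..t, A s with hB
  set G : ℝ → ℝ := fun t => ∫ s in (0 : ℝ)..t, A s * E s with hG
  have hBac : AbsolutelyContinuousOnInterval B 0 T :=
    hA.absolutelyContinuousOnInterval_intervalIntegral h0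
  have hGac : AbsolutelyContinuousOnInterval G 0 T :=
    hAE.absolutelyContinuousOnInterval_intervalIntegral h0
  have hDac : AbsolutelyContinuousOnInterval (fun _ : ℝ => D) 0 T :=
    (LipschitzWith.const D).lipschitzOnWith.absolutelyContinuousOnInterval
  have hB0 : ∀ t ∈ uIcc 0 T, -B t ∈ Iic (0 : ℝ) := by
    intro t ht
    rw [hu] at ht
    simp only [mem_Iic, Left.neg_nonpos_iff, hB]
    exact intervalIntegral.integral_nonneg ht.1 fun s _ => hA0 s
  have hexp : LipschitzOnWith 1 Real.exp (Iic (0 : ℝ)) := by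
    refine Convex.lipschitzOnWith_of_nnnorm_deriv_le (fun x _ => Real.differentiableAt_exp)
      (fun x hx => ?_) (convex_Iic 0)
    rw [Real.deriv_exp, ← NNReal.coe_le_coe]
    simpa [abs_of_pos (Real.exp_pos x)] using hx
  have hXac : AbsolutelyContinuousOnInterval (fun t => Real.exp (-B t)) 0 T :=
    absolutelyContinuousOnInterval_lipschitz_comp hexp hBac.neg hB0
  have hDG := hDac.add hGac
  have hWac := hDG.fun_mul hXac
  have hFTC := hWac.integral_deriv_eq_sub
  have hderiv : ∀ᵐ x, x ∈ uIcc 0 T →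
      deriv (fun t => ((fun _ : ℝ => D) + G) t * Real.exp (-B t)) x ≤ 0 := by
    filter_upwards [hA.ae_hasDerivAt_integral, hAE.ae_hasDerivAt_integral] with x h1 h2 hx
    have d1 := h1 hx 0 h0
    have d2 := h2 hx 0 h0
    have d3 : HasDerivAt ((fun _ : ℝ => D) + G) (A x * E x) x := by
      have := (hasDerivAt_const x D).add d2
      simpa using this
    have d4 : HasDerivAt (fun t => Real.exp (-B t)) (Real.exp (-B x) * (-A x)) x := d1.neg.exp
    have d5 := d3.mul d4
    have e : deriv (fun t => ((fun _ : ℝ => D) + G) t * Real.exp (-B t)) x = _ := d5.deriv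
    rw [e]
    have hx' : x ∈ Icc 0 T := by rwa [hu] at hx
    have h3 := h x hx'
    have : A x * E x * Real.exp (-B x) + (D + G x) * (Real.exp (-B x) * -A x)
        = (A x * Real.exp (-B x)) * (E x - (D + G x)) := by ring
    simp only [Pi.add_apply]
    rw [this]
    exact mul_nonpos_of_nonneg_of_nonpos (mul_nonneg (hA0 x) (Real.exp_pos _).le)
      (by simpa [hG] using h3)
  have hle : ∫ x in (0 : ℝ)..T, deriv (fun t => ((fun _ : ℝ => D) + G) t * Real.exp (-B t)) x
      ≤ 0 := by
    rw [intervalIntegral.integral_of_le hT]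
    refine integral_nonpos_of_ae ?_
    filter_upwards [ae_restrict_of_ae hderiv, ae_restrict_mem measurableSet_Ioc] with x h1 h2
    exact h1 (by rw [hu]; exact Ioc_subset_Icc_self h2)
  rw [hFTC] at hle
  simp only [Pi.add_apply, hB, hG, intervalIntegral.integral_same, neg_zero, Real.exp_zero,
    add_zero, mul_one] at hle
  have h4 := h T (right_mem_Icc.2 hT)
  have h5 : (D + ∫ s in (0 : ℝ)..T, A s * E s) ≤ D * Real.exp (∫ s in (0 : ℝ)..T, A s) := by
    rw [Real.exp_neg] at hle
    have hp := Real.exp_pos (∫ s in (0 : ℝ)..T, A s)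
    have := sub_nonpos.1 hle
    rwa [← div_eq_mul_inv, div_le_iff₀ hp] at this
  exact h4.trans h5

/-! ### Jointly measurable representatives -/

/-- A strongly measurable function into `L^p(X; E)` has a jointly measurable representative. -/
theorem exists_joint_representative {S X E : Type*} [MeasurableSpace S] [MeasurableSpace X]
    [NormedAddCommGroup E] [CompleteSpace E] {μ : Measure X} {p : ℝ≥0∞} [Fact (1 ≤ p)]
    {f : S → Lp E p μ} (hf : StronglyMeasurable f) :
    ∃ U : S × X → E, StronglyMeasurable U ∧ ∀ s, (fun x => U (s, x)) =ᵐ[μ] f s := by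
  rcases isEmpty_or_nonempty S with hS | hS
  · exact ⟨0, stronglyMeasurable_zero, fun s => (hS.false s).elim⟩
  have hsep := hf.isSeparable_range
  obtain ⟨c, hc, hcd⟩ := hsep
  have hne : c.Nonempty := by
    by_contra h
    rw [not_nonempty_iff_eq_empty] at h
    subst h
    simp at hcd
  obtain ⟨d, hd⟩ := hc.exists_eq_range hne
  have hex : ∀ k : ℕ, ∀ s, ∃ i, dist (f s) (d i) < (1 / 2 : ℝ) ^ k := by
    intro k s
    have := hcd (mem_range_self s)
    rw [Metric.mem_closure_iff] at this
    obtain ⟨b, hb, hb'⟩ := this _ (by positivity : (0 : ℝ) < (1 / 2 : ℝ) ^ k)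
    rw [hd] at hb
    obtain ⟨i, rfl⟩ := hb
    exact ⟨i, hb'⟩
  classical
  -- Choosing the first admissible index of a dense sequence makes the approximation measurable in
  -- `s` with countably many values, so that joint measurability of `V k` is immediate.
  let N : ℕ → S → ℕ := fun k s => Nat.find (hex k s)
  have hN : ∀ k, Measurable (N k) := by
    intro k
    refine measurable_find _ fun i => ?_
    exact measurableSet_lt (hf.dist stronglyMeasurable_const).measurable measurable_const
  have hNd : ∀ k s, dist (f s) (d (N k s)) < (1 / 2 : ℝ) ^ k := fun k s => Nat.find_spec (hex k s)
  let V : ℕ → S × X → E := fun k z => d (N k z.1) z.2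
  have hV : ∀ k, StronglyMeasurable (V k) := by
    intro k
    have h1 : StronglyMeasurable (fun z : ℕ × X => d z.1 z.2) := by
      borelize E
      refine stronglyMeasurable_iff_measurable_separable.2
        ⟨measurable_from_prod_countable_right fun i => (Lp.stronglyMeasurable (d i)).measurable, ?_⟩
      refine (TopologicalSpace.IsSeparable.iUnion fun i =>
        (Lp.stronglyMeasurable (d i)).isSeparable_range).mono ?_
      rintro _ ⟨z, rfl⟩
      exact mem_iUnion.2 ⟨z.1, mem_range_self z.2⟩
    exact h1.comp_measurable (((hN k).comp measurable_fst).prodMk measurable_snd)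
  refine ⟨fun z => limUnder atTop fun k => V k z, StronglyMeasurable.limUnder hV, fun s => ?_⟩
  have hconv : ∀ᵐ x ∂μ, Tendsto (fun k => V k (s, x)) atTop (𝓝 (f s x)) := by
    -- The geometric rate gives almost everywhere convergence of the full sequence for each `s`. No
    -- subsequence depending on `s` may enter the definition of the limit, or joint measurability
    -- would be lost.
    have hsum : ∑' k : ℕ, ENNReal.ofReal (2 * (1 / 2 : ℝ) ^ k) ≠ ∞ := by
      rw [← ENNReal.ofReal_tsum_of_nonneg (fun k => by positivity)
        (summable_geometric_two.mul_left 2)]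
      exact ENNReal.ofReal_ne_top
    have h1 : ∀ᵐ x ∂μ, ∃ l : E, Tendsto (fun k => d (N k s) x) atTop (𝓝 l) := by
      refine Lp.ae_tendsto_of_cauchy_eLpNorm (p := p) (fun k => Lp.aestronglyMeasurable _)
        Fact.out hsum fun M n m hn hm => ?_
      rw [← Lp.edist_def, edist_dist]
      refine (ENNReal.ofReal_lt_ofReal_iff (by positivity)).2 ?_
      have a1 := hNd n s
      have a2 := hNd m s
      have b1 : (1 / 2 : ℝ) ^ n ≤ (1 / 2) ^ M :=
        pow_le_pow_of_le_one (by norm_num) (by norm_num) hn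
      have b2 : (1 / 2 : ℝ) ^ m ≤ (1 / 2) ^ M :=
        pow_le_pow_of_le_one (by norm_num) (by norm_num) hm
      have := dist_triangle_left (d (N n s)) (d (N m s)) (f s)
      linarith
    have h2 : Tendsto (fun k => d (N k s)) atTop (𝓝 (f s)) := by
      rw [tendsto_iff_dist_tendsto_zero]
      refine squeeze_zero (fun _ => dist_nonneg) (fun k => ?_)
        (tendsto_pow_atTop_nhds_zero_of_lt_one (r := (1 / 2 : ℝ)) (by norm_num) (by norm_num))
      rw [dist_comm]
      exact (hNd k s).le
    -- A subsequence is harmless here: it only identifies the limit already known to exist.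
    have h3 : TendstoInMeasure μ (fun k => (d (N k s) : X → E)) atTop (f s) :=
      tendstoInMeasure_of_tendsto_Lp h2
    obtain ⟨ns, hns, h4⟩ := h3.exists_seq_tendsto_ae
    filter_upwards [h1, h4] with x ⟨l, hl⟩ hx
    rw [tendsto_nhds_unique hx (hl.comp hns.tendsto_atTop)]
    exact hl
  filter_upwards [hconv] with x hx
  exact hx.limUnder_eq

/-! ### The energy identity from Steklov averages -/

/-- The shear `(s, ρ) ↦ (s, s + ρ)` preserves measure and carries `S × I` into the square where `P`
is integrable. -/
theorem integrableOn_kernel_shear {T : ℝ} {P : ℝ → ℝ → ℝ} (hP : DiagContinuous T P)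
    {S I : Set ℝ} (hS : MeasurableSet S) (hI : MeasurableSet I) (hST : S ⊆ Ioc 0 T)
    (hSI : ∀ s ∈ S, ∀ ρ ∈ I, s + ρ ∈ Ioc 0 T) :
    Integrable (fun z : ℝ × ℝ => P (z.1 + z.2) z.1)
      ((volume.restrict S).prod (volume.restrict I)) := by
  have h1 : IntegrableOn (fun z : ℝ × ℝ => P z.2 z.1) (Ioc 0 T ×ˢ Ioc 0 T) := by
    have := hP.integrable
    rw [IntegrableOn, Measure.volume_eq_prod, ← Measure.prod_restrict] at this ⊢
    exact this.swap
  rw [← integrable_indicator_iff (measurableSet_Ioc.prod measurableSet_Ioc)] at h1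
  have h2 : MeasurePreserving (fun z : ℝ × ℝ => (z.1, z.1 + z.2)) volume volume :=
    measurePreserving_prod_add volume volume
  have h3 := h2.integrable_comp_of_integrable h1
  rw [Measure.prod_restrict]
  refine (h3.integrableOn (s := S ×ˢ I)).congr_fun ?_ (hS.prod hI)
  rintro ⟨s, ρ⟩ ⟨h4, h5⟩
  simp only [Function.comp]
  rw [indicator_of_mem]
  exact ⟨hST h4, hSI s h4 ρ h5⟩

/-- Substituting `r = s + ρ` and exchanging integrals turns the left side into an integral over
shifts `ρ ∈ (c, c + h]` of `∫_S P(s + ρ, s) ds`, each within `ε` of the diagonal integral. The case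
`c = 0` is the forward Steklov average, `c = -h` the backward one. -/
theorem abs_sub_le_of_shear {T : ℝ} {P : ℝ → ℝ → ℝ} (hP : DiagContinuous T P)
    {S : Set ℝ} {c h δ ε : ℝ} (hS : MeasurableSet S) (hST : S ⊆ Ioc 0 T) (hh : 0 < h)
    (hSI : ∀ s ∈ S, ∀ ρ ∈ Ioc c (c + h), s + ρ ∈ Ioc 0 T)
    (hc : ∀ ρ ∈ Ioc c (c + h), |ρ| < δ)
    (hδ : ∀ ρ, |ρ| < δ → ∀ S, MeasurableSet S → |∫ s in S, (P (s + ρ) s - P s s)| ≤ ε) :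
    IntegrableOn (fun s => ∫ r in (s + c)..(s + c + h), P r s) S ∧
    |(∫ s in S, ∫ r in (s + c)..(s + c + h), P r s) - h * ∫ s in S, P s s| ≤ h * ε := by
  have hint := integrableOn_kernel_shear hP hS (measurableSet_Ioc (a := c) (b := c + h)) hST hSI
  have e : ∀ s, ∫ r in (s + c)..(s + c + h), P r s = ∫ ρ in Ioc c (c + h), P (s + ρ) s := by
    intro s
    rw [← intervalIntegral.integral_of_le (by linarith),
      intervalIntegral.integral_comp_add_left (fun r => P r s), add_assoc]
  simp_rw [e]
  refine ⟨hint.integral_prod_left, ?_⟩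
  rw [integral_integral_swap hint]
  have e2 : h * ∫ s in S, P s s = ∫ _ in Ioc c (c + h), ∫ s in S, P s s := by
    simp [hh.le]
  rw [e2, ← integral_sub hint.integral_prod_right (by simp)]
  have e3 : ∀ ρ, (∫ s in S, P (s + ρ) s) - ∫ s in S, P s s
      = ∫ s in S, (P (s + ρ) s - P s s) := fun ρ =>
    (integral_sub (hP.shift ρ).integrableOn hP.diag.integrableOn).symm
  simp_rw [e3]
  have := norm_setIntegral_le_of_norm_le_const (μ := volume) (s := Ioc c (c + h)) (C := ε)
    (f := fun ρ => ∫ s in S, (P (s + ρ) s - P s s)) (by simp) (fun ρ hρ => hδ ρ (hc ρ hρ) S hS)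
  simpa [hh.le, mul_comm] using this

theorem abs_setIntegral_sub_le_of_near {E : ℝ → ℝ} {a b x ε : ℝ} (hab : a ≤ b)
    (hi : IntervalIntegrable E volume a b) (h : ∀ s ∈ Ioc a b, |E s - E x| ≤ ε) :
    |(∫ s in a..b, E s) - (b - a) * E x| ≤ (b - a) * ε := by
  have e : (∫ s in a..b, E s) - (b - a) * E x = ∫ s in a..b, (E s - E x) := by
    rw [intervalIntegral.integral_sub hi (by simp)]
    simp
  rw [e]
  have := intervalIntegral.norm_integral_le_of_norm_le_const (a := a) (b := b) (C := ε)
    (f := fun s => E s - E x) (fun s hs => by rw [uIoc_of_le hab] at hs; exact h s hs)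
  rw [abs_of_nonneg (sub_nonneg.2 hab)] at this
  simpa [mul_comm] using this

/-- If the increments of `E` are given by a kernel that is continuous at the diagonal in the mean,
then `E` is the primitive of twice the diagonal of the kernel. -/
theorem energy_identity_of_increments {E : ℝ → ℝ} {T : ℝ} {P : ℝ → ℝ → ℝ} {G : Set ℝ}
    (hP : DiagContinuous T P) (hE : ContinuousOn E (Icc 0 T))
    (hG : ∀ᵐ s ∂volume.restrict (Ioc 0 T), s ∈ G)
    (hinc : ∀ s ∈ G ∩ Ioc 0 T, ∀ s' ∈ G ∩ Ioc 0 T, s ≤ s' →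
      E s' - E s = (∫ r in s..s', P r s') + ∫ r in s..s', P r s)
    {t : ℝ} (ht : t ∈ Icc 0 T) :
    E t - E 0 = 2 * ∫ s in (0 : ℝ)..t, P s s := by
  rcases ht.1.eq_or_lt with rfl | ht0
  · simp
  have hdi : ∀ a b, IntervalIntegrable (fun s => P s s) volume a b := fun a b =>
    hP.diag.intervalIntegrable
  have hEi : ∀ a ∈ Icc 0 T, ∀ b ∈ Icc 0 T, IntervalIntegrable E volume a b := by
    intro a ha b hb
    exact (hE.mono (uIcc_subset_Icc ha hb)).intervalIntegrable
  have hD : Continuous fun x => ∫ s in (0 : ℝ)..x, P s s :=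
    intervalIntegral.continuous_primitive hdi 0
  -- Six errors: the forward and backward averages of `P`, the averages of `E` near `t` and near
  -- `0`, and the two end pieces missing from the diagonal integrals over `(0, t - h]` and `(h, t]`.
  suffices ∀ ε > 0, |E t - E 0 - 2 * ∫ s in (0 : ℝ)..t, P s s| ≤ 6 * ε by
    refine sub_eq_zero.1 (abs_eq_zero.1 (le_antisymm (le_of_forall_pos_le_add fun ε hε => ?_)
      (abs_nonneg _)))
    have := this (ε / 6) (by positivity)
    linarith
  intro ε hε
  obtain ⟨δ₁, hδ₁, h1⟩ := hP.near ε hε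
  obtain ⟨δ₂, hδ₂, h2⟩ := Metric.continuousWithinAt_iff.1 (hE t ht) ε hε
  have h0T : (0 : ℝ) ∈ Icc 0 T := ⟨le_rfl, ht.1.trans ht.2⟩
  obtain ⟨δ₃, hδ₃, h3⟩ := Metric.continuousWithinAt_iff.1 (hE 0 h0T) ε hε
  obtain ⟨δ₄, hδ₄, h4⟩ := Metric.continuousAt_iff.1 (hD.continuousAt (x := t)) ε hε
  obtain ⟨δ₅, hδ₅, h5⟩ := Metric.continuousAt_iff.1 (hD.continuousAt (x := 0)) ε hε
  obtain ⟨h, hh, hlt⟩ := exists_between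
    (lt_min (lt_min (lt_min hδ₁ hδ₂) (lt_min hδ₃ hδ₄)) (lt_min hδ₅ ht0))
  simp only [lt_min_iff] at hlt
  obtain ⟨⟨⟨k1, k2⟩, k3, k4⟩, k5, k6⟩ := hlt
  have tT := ht.2
  obtain ⟨iA, bA⟩ := abs_sub_le_of_shear (c := 0) (h := h) hP (S := Ioc 0 (t - h))
    measurableSet_Ioc (Ioc_subset_Ioc_right (by linarith)) hh
    (fun s hs ρ hρ => ⟨by linarith [hs.1, hρ.1], by linarith [hs.2, hρ.2]⟩)
    (fun ρ hρ => by rw [abs_of_nonneg hρ.1.le]; linarith [hρ.2]) h1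
  obtain ⟨iB, bB⟩ := abs_sub_le_of_shear (c := -h) (h := h) hP (S := Ioc h t)
    measurableSet_Ioc (Ioc_subset_Ioc hh.le tT) hh
    (fun s hs ρ hρ => ⟨by linarith [hs.1, hρ.1], by linarith [hs.2, hρ.2]⟩)
    (fun ρ hρ => by rw [abs_of_nonpos (by linarith [hρ.2])]; linarith [hρ.1]) h1
  simp only [add_zero, neg_add_cancel_right] at iA bA iB bB
  rw [← intervalIntegral.integral_of_le (by linarith),
    ← intervalIntegral.integral_of_le (by linarith)] at bA bB
  have hX1 : ∫ s in (0 : ℝ)..(t - h), (E (s + h) - E s)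
      = (∫ s in (t - h)..t, E s) - ∫ s in (0 : ℝ)..h, E s := by
    have m1 : t - h ∈ Icc 0 T := ⟨by linarith, by linarith⟩
    have m2 : h ∈ Icc 0 T := ⟨by linarith, by linarith⟩
    have c := (hEi h m2 t ht).comp_add_right h
    simp only [sub_self] at c
    rw [intervalIntegral.integral_sub c (hEi 0 h0T _ m1),
      intervalIntegral.integral_comp_add_right]
    have a1 := intervalIntegral.integral_add_adjacent_intervals (hEi 0 h0T _ m1) (hEi _ m1 t ht)
    have a2 := intervalIntegral.integral_add_adjacent_intervals (hEi 0 h0T _ m2) (hEi _ m2 t ht)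
    simp only [zero_add, sub_add_cancel]
    linarith
  -- Shifting `s` by `h` turns the terms `P(r, s + h)` into backward averages over `(s - h, s]` with
  -- `s ∈ (h, t]`.
  have hX2 : ∫ s in (0 : ℝ)..(t - h), (E (s + h) - E s)
      = (∫ s in h..t, ∫ r in (s + -h)..s, P r s)
        + ∫ s in (0 : ℝ)..(t - h), ∫ r in s..(s + h), P r s := by
    have iB' : IntervalIntegrable (fun s => ∫ r in (s + -h)..s, P r s) volume h t :=
      (intervalIntegrable_iff_integrableOn_Ioc_of_le (by linarith)).2 iB
    have iA' : IntervalIntegrable (fun s => ∫ r in s..(s + h), P r s) volume 0 (t - h) :=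
      (intervalIntegrable_iff_integrableOn_Ioc_of_le (by linarith)).2 iA
    have c := iB'.comp_add_right h
    simp only [sub_self] at c
    have e := intervalIntegral.integral_comp_add_right (a := 0) (b := t - h)
      (fun s => ∫ r in (s + -h)..s, P r s) h
    simp only [zero_add, sub_add_cancel] at e
    rw [← e, ← intervalIntegral.integral_add c iA']
    refine intervalIntegral.integral_congr_ae ?_
    rw [ae_restrict_iff' measurableSet_Ioc] at hG
    -- Translates of null sets are null, so almost every `s` has both `s` and `s + h` in `G`.
    have hG' := (measurePreserving_add_right volume h).quasiMeasurePreserving.ae hG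
    filter_upwards [hG, hG'] with s g1 g2 hs
    rw [uIoc_of_le (by linarith)] at hs
    have m1 : s ∈ Ioc 0 T := ⟨hs.1, by linarith [hs.2]⟩
    have m2 : s + h ∈ Ioc 0 T := ⟨by linarith [hs.1], by linarith [hs.2]⟩
    simp only [add_neg_cancel_right]
    exact hinc s ⟨g1 m1, m1⟩ (s + h) ⟨g2 m2, m2⟩ (by linarith)
  have b1 := abs_setIntegral_sub_le_of_near (E := E) (a := t - h) (b := t) (x := t) (ε := ε)
    (by linarith) (hEi _ ⟨by linarith, by linarith⟩ _ ht) (fun s hs =>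
      (h2 (x := s) ⟨by linarith [hs.1], by linarith [hs.2]⟩ (by
        rw [Real.dist_eq, abs_lt]; constructor <;> linarith [hs.1, hs.2])).le)
  have b2 := abs_setIntegral_sub_le_of_near (E := E) (a := 0) (b := h) (x := 0) (ε := ε)
    hh.le (hEi _ h0T _ ⟨by linarith, by linarith⟩) (fun s hs =>
      (h3 (x := s) ⟨by linarith [hs.1], by linarith [hs.2]⟩ (by
        rw [Real.dist_eq, abs_lt]; constructor <;> linarith [hs.1, hs.2])).le)
  have b3 := h4 (x := t - h) (by rw [Real.dist_eq, abs_lt]; constructor <;> linarith)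
  have b4 := h5 (x := h) (by rw [Real.dist_eq, abs_lt]; constructor <;> linarith)
  have a2 := intervalIntegral.integral_add_adjacent_intervals (hdi 0 h) (hdi h t)
  rw [Real.dist_eq] at b3 b4
  simp only [intervalIntegral.integral_same, sub_zero, sub_sub_cancel] at b1 b2 b3 b4
  set D := ∫ s in (0 : ℝ)..t, P s s
  set D1 := ∫ s in (0 : ℝ)..(t - h), P s s
  set D2 := ∫ s in h..t, P s s
  set D3 := ∫ s in (0 : ℝ)..h, P s s
  set I1 := ∫ s in (t - h)..t, E s
  set I2 := ∫ s in (0 : ℝ)..h, E s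
  have hX := hX1.symm.trans hX2
  rw [abs_le] at bA bB b1 b2
  rw [abs_lt] at b3 b4
  have key : h * |E t - E 0 - 2 * D| ≤ h * (6 * ε) := by
    rw [← abs_of_pos hh, ← abs_mul, abs_of_pos hh, abs_le]
    have c1 : h * (D1 - D) ≤ h * ε := mul_le_mul_of_nonneg_left b3.2.le hh.le
    have c2 : h * (-ε) ≤ h * (D1 - D) := mul_le_mul_of_nonneg_left b3.1.le hh.le
    have c3 : h * D3 ≤ h * ε := mul_le_mul_of_nonneg_left b4.2.le hh.le
    have c4 : h * (-ε) ≤ h * D3 := mul_le_mul_of_nonneg_left b4.1.le hh.le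
    have c5 : h * D3 + h * D2 = h * D := by rw [← mul_add, a2]
    constructor <;> linarith
  exact le_of_mul_le_mul_left key hh

/-! ### The Gagliardo difference quotient -/

/-- The difference quotient `(u(x) - u(y)) / |x-y|^{n/2+α}`. -/
noncomputable def gag {n : ℕ} (α : ℝ) (u : Rn n → ℝ) (z : Rn n × Rn n) : ℝ :=
  (u z.1 - u z.2) / ‖z.1 - z.2‖ ^ (((n : ℝ) + 2 * α) / 2)

theorem rpow_half_mul_self {r d : ℝ} (hr : 0 ≤ r) : r ^ (d / 2) * r ^ (d / 2) = r ^ d := by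
  rw [← pow_two, ← Real.rpow_natCast, ← Real.rpow_mul hr]
  congr 1
  push_cast
  ring

theorem gag_mul_gag {n : ℕ} (α : ℝ) (u w : Rn n → ℝ) (z : Rn n × Rn n) :
    gag α u z * gag α w z
      = (u z.1 - u z.2) * (w z.1 - w z.2) / ‖z.1 - z.2‖ ^ ((n : ℝ) + 2 * α) := by
  rw [gag, gag, div_mul_div_comm, rpow_half_mul_self (norm_nonneg _)]

theorem gag_sq {n : ℕ} (α : ℝ) (u : Rn n → ℝ) (z : Rn n × Rn n) :
    gag α u z ^ 2 = (u z.1 - u z.2) ^ 2 / ‖z.1 - z.2‖ ^ ((n : ℝ) + 2 * α) := by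
  rw [pow_two, gag_mul_gag, pow_two]

/-- The nonlocal Leibniz rule. The second term is the commutator to be shown small. -/
theorem gag_mul {n : ℕ} (α : ℝ) (η u : Rn n → ℝ) (z : Rn n × Rn n) :
    gag α (fun x => η x * u x) z = η z.1 * gag α u z + u z.2 * gag α η z := by
  simp only [gag]
  ring

theorem measurable_gag {n : ℕ} (α : ℝ) {u : Rn n → ℝ} (hu : Measurable u) :
    Measurable (gag α u) := by
  unfold gag
  fun_prop

theorem gag_congr_ae {n : ℕ} (α : ℝ) {u w : Rn n → ℝ} (h : u =ᵐ[volume] w) :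
    gag α u =ᵐ[volume] gag α w := by
  have h1 := Measure.quasiMeasurePreserving_fst (μ := (volume : Measure (Rn n)))
    (ν := (volume : Measure (Rn n))) |>.ae h
  have h2 := Measure.quasiMeasurePreserving_snd (μ := (volume : Measure (Rn n)))
    (ν := (volume : Measure (Rn n))) |>.ae h
  filter_upwards [h1, h2] with z a b
  simp only [gag, a, b]

theorem aestronglyMeasurable_gag {n : ℕ} (α : ℝ) {u : Rn n → ℝ}
    (hu : AEStronglyMeasurable u volume) : AEStronglyMeasurable (gag α u) volume :=
  ⟨gag α (hu.mk u), (measurable_gag α hu.stronglyMeasurable_mk.measurable).stronglyMeasurable,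
    gag_congr_ae α hu.ae_eq_mk⟩

theorem fracConst_pos {n : ℕ} {α : ℝ} (h0 : 0 < α) (h1 : α < 1) : 0 < fracConst n α := by
  unfold fracConst
  have := Real.Gamma_pos_of_pos (s := ((n : ℝ) + 2 * α) / 2) (by positivity)
  have := Real.Gamma_pos_of_pos (s := 1 - α) (by linarith)
  have := Real.pi_pos
  positivity

theorem enorm_sq_eq_ofReal_sq (r : ℝ) : ‖r‖ₑ ^ 2 = ENNReal.ofReal (r ^ 2) := by
  rw [Real.enorm_eq_ofReal_abs, ← ENNReal.ofReal_pow (abs_nonneg r), sq_abs]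

theorem sobolevNormSq_eq {n : ℕ} (α : ℝ) (u : H n) :
    sobolevNormSq α u = (∫⁻ x, ‖u x‖ₑ ^ 2)
      + ENNReal.ofReal (fracConst n α / 2) * ∫⁻ z, ‖gag α u z‖ₑ ^ 2 := by
  simp only [enorm_sq_eq_ofReal_sq, gag_sq]
  rfl

theorem memLp_two_iff_lintegral {X : Type*} [MeasurableSpace X] {μ : Measure X} {f : X → ℝ}
    (hf : AEStronglyMeasurable f μ) : MemLp f 2 μ ↔ ∫⁻ x, ‖f x‖ₑ ^ 2 ∂μ < ∞ := by
  have h := eLpNorm_lt_top_iff_lintegral_rpow_enorm_lt_top (f := f) (μ := μ) (p := 2)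
    (by norm_num) (by norm_num)
  simp only [ENNReal.toReal_ofNat, ENNReal.rpow_ofNat] at h
  exact ⟨fun a => h.1 a.2, fun a => ⟨hf, h.2 a⟩⟩

/-- The `L²` part of the norm is finite already. Positivity of `fracConst` matters, since `0 * ∞ =
0` would hide an infinite seminorm. -/
theorem memSobolev_iff {n : ℕ} {α : ℝ} (h0 : 0 < α) (h1 : α < 1) (u : H n) :
    MemSobolev α u ↔ MemLp (gag α u) 2 volume := by
  have hu : ∫⁻ x, ‖u x‖ₑ ^ 2 < ∞ :=
    (memLp_two_iff_lintegral (Lp.aestronglyMeasurable u)).1 (Lp.memLp u)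
  rw [MemSobolev, sobolevNormSq_eq, ENNReal.add_lt_top,
    memLp_two_iff_lintegral (aestronglyMeasurable_gag α (Lp.aestronglyMeasurable u))]
  have hc : 0 < ENNReal.ofReal (fracConst n α / 2) :=
    ENNReal.ofReal_pos.2 (half_pos (fracConst_pos h0 h1))
  constructor
  · rintro ⟨-, h⟩
    by_contra h2
    rw [not_lt, top_le_iff] at h2
    rw [h2, ENNReal.mul_top hc.ne'] at h
    exact lt_irrefl _ h
  · exact fun h => ⟨hu, ENNReal.mul_lt_top ENNReal.ofReal_lt_top h⟩

theorem fracForm_eq {n : ℕ} (α : ℝ) (u w : H n) :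
    fracForm α u w = fracConst n α / 2 * ∫ z, gag α u z * gag α w z := by
  simp only [gag_mul_gag]
  rfl

/-! ### Weights and commutators -/

/-- `∫ min(L²|z|², 1) / |z|^{n+2α} dz`. -/
noncomputable def kernelMass (n : ℕ) (α L : ℝ) : ℝ≥0∞ :=
  ∫⁻ z : Rn n, ENNReal.ofReal (min ((L * ‖z‖) ^ 2) 1 / ‖z‖ ^ ((n : ℝ) + 2 * α))

/-- In polar coordinates the integrand is `r^(1 - 2α)` on `(0, 1]`, integrable as `α < 1`, and
`r^(-1 - 2α)` beyond 1, integrable as `α > 0`. -/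
theorem integrable_min_sq_div_rpow {n : ℕ} {α : ℝ} (h0 : 0 < α) (h1 : α < 1) :
    Integrable fun z : Rn n => min (‖z‖ ^ 2) 1 / ‖z‖ ^ ((n : ℝ) + 2 * α) := by
  -- Polar coordinates need a nontrivial space; in dimension 0 the integrand is zero.
  rcases Nat.eq_zero_or_pos n with rfl | hn
  · have : (fun z : Rn 0 => min (‖z‖ ^ 2) 1 / ‖z‖ ^ (((0 : ℕ) : ℝ) + 2 * α)) = fun _ => 0 := by
      ext z
      have : z = 0 := Subsingleton.elim _ _
      simp [this]
    rw [this]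
    exact integrable_zero _ _ _
  have : Nonempty (Fin n) := ⟨⟨0, hn⟩⟩
  have : Nontrivial (Rn n) := inferInstance
  rw [integrable_fun_norm_addHaar (volume : Measure (Rn n))
    (f := fun r : ℝ => min (r ^ 2) 1 / r ^ ((n : ℝ) + 2 * α))]
  rw [finrank_euclideanSpace_fin, ← Ioc_union_Ioi_eq_Ioi (zero_le_one (α := ℝ))]
  refine IntegrableOn.union ?_ ?_
  · have h2 : IntegrableOn (fun r : ℝ => r ^ (1 - 2 * α)) (Ioc 0 1) :=
      (intervalIntegrable_iff_integrableOn_Ioc_of_le zero_le_one).1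
        (intervalIntegral.intervalIntegrable_rpow' (by linarith))
    refine h2.congr_fun (fun r hr => ?_) measurableSet_Ioc
    have hr0 : 0 < r := hr.1
    have hm : min (r ^ 2) 1 = r ^ 2 := min_eq_left (pow_le_one₀ hr0.le hr.2)
    simp only [hm, smul_eq_mul]
    rw [← Real.rpow_natCast r (n - 1), ← Real.rpow_natCast r 2, ← Real.rpow_sub hr0,
      ← Real.rpow_add hr0]
    congr 1
    push_cast [Nat.cast_sub hn]
    ring
  · have h2 : IntegrableOn (fun r : ℝ => r ^ (-1 - 2 * α)) (Ioi 1) :=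
      integrableOn_Ioi_rpow_of_lt (by linarith) one_pos
    refine h2.congr_fun (fun r hr => ?_) measurableSet_Ioi
    have hr0 : 0 < r := one_pos.trans hr
    have hm : min (r ^ 2) 1 = 1 := min_eq_right (one_le_pow₀ (le_of_lt hr))
    simp only [hm, smul_eq_mul]
    rw [← Real.rpow_natCast r (n - 1), one_div, ← Real.rpow_neg hr0.le, ← Real.rpow_add hr0]
    congr 1
    push_cast [Nat.cast_sub hn]
    ring

theorem min_mul_sq_le {L r : ℝ} (hL0 : 0 ≤ L) (hL1 : L ≤ 1) (hr : 0 ≤ r) :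
    min ((L * r) ^ 2) 1 ≤ min (r ^ 2) 1 :=
  min_le_min_right _ (pow_le_pow_left₀ (mul_nonneg hL0 hr) (mul_le_of_le_one_left hr hL1) 2)

theorem kernelMass_lt_top {n : ℕ} {α L : ℝ} (h0 : 0 < α) (h1 : α < 1) (hL0 : 0 ≤ L)
    (hL1 : L ≤ 1) : kernelMass n α L < ∞ := by
  refine lt_of_le_of_lt ?_ (integrable_min_sq_div_rpow (n := n) h0 h1).lintegral_lt_top
  refine lintegral_mono fun z => ENNReal.ofReal_le_ofReal ?_
  exact div_le_div_of_nonneg_right (min_mul_sq_le hL0 hL1 (norm_nonneg z)) (by positivity)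

/-- Dominated convergence, with the integrand for `L = 1` as majorant. -/
theorem tendsto_kernelMass {n : ℕ} {α : ℝ} (h0 : 0 < α) (h1 : α < 1) :
    Tendsto (fun m : ℕ => kernelMass n α (1 / ((m : ℝ) + 1))) atTop (𝓝 0) := by
  have hL : ∀ m : ℕ, 0 ≤ 1 / ((m : ℝ) + 1) ∧ 1 / ((m : ℝ) + 1) ≤ 1 := fun m =>
    ⟨by positivity, by rw [div_le_one (by positivity)]; linarith [(Nat.cast_nonneg m : (0:ℝ) ≤ m)]⟩
  have := tendsto_lintegral_of_dominated_convergence (μ := (volume : Measure (Rn n)))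
    (F := fun (m : ℕ) z => ENNReal.ofReal
      (min ((1 / ((m : ℝ) + 1) * ‖z‖) ^ 2) 1 / ‖z‖ ^ ((n : ℝ) + 2 * α)))
    (f := fun _ => 0)
    (fun z => ENNReal.ofReal (min (‖z‖ ^ 2) 1 / ‖z‖ ^ ((n : ℝ) + 2 * α)))
    (fun m => by fun_prop)
    (fun m => ae_of_all _ fun z => ENNReal.ofReal_le_ofReal (div_le_div_of_nonneg_right
      (min_mul_sq_le (hL m).1 (hL m).2 (norm_nonneg z)) (by positivity)))
    (integrable_min_sq_div_rpow (n := n) h0 h1).lintegral_lt_top.ne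
    (ae_of_all _ fun z => by
      have t1 : Tendsto (fun m : ℕ => min ((1 / ((m : ℝ) + 1) * ‖z‖) ^ 2) 1
          / ‖z‖ ^ ((n : ℝ) + 2 * α)) atTop
          (𝓝 (min ((0 * ‖z‖) ^ 2) 1 / ‖z‖ ^ ((n : ℝ) + 2 * α))) :=
        (((tendsto_one_div_add_atTop_nhds_zero_nat.mul_const _).pow 2).min
          tendsto_const_nhds).div_const _
      have t2 := ENNReal.tendsto_ofReal t1
      simpa using t2)
  simpa [kernelMass] using this

/-- A measurable weight with values in `[0,1]` and Lipschitz constant `L ≤ 1`. -/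
structure IsWeight {n : ℕ} (L : ℝ) (η : Rn n → ℝ) : Prop where
  measurable : Measurable η
  nonneg : ∀ x, 0 ≤ η x
  le_one : ∀ x, η x ≤ 1
  lip : ∀ x y, |η x - η y| ≤ L * ‖x - y‖
  L_nonneg : 0 ≤ L
  L_le_one : L ≤ 1

theorem IsWeight.gag_sq_le {n : ℕ} {L : ℝ} {η : Rn n → ℝ} (hη : IsWeight L η) (α : ℝ)
    (z : Rn n × Rn n) :
    gag α η z ^ 2 ≤ min ((L * ‖z.1 - z.2‖) ^ 2) 1 / ‖z.1 - z.2‖ ^ ((n : ℝ) + 2 * α) := by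
  rw [gag_sq]
  refine div_le_div_of_nonneg_right (le_min ?_ ?_) (by positivity)
  · rw [← sq_abs]
    exact pow_le_pow_left₀ (abs_nonneg _) (hη.lip _ _) 2
  · rw [sq_le_one_iff_abs_le_one, abs_le]
    constructor <;> linarith [hη.nonneg z.1, hη.nonneg z.2, hη.le_one z.1, hη.le_one z.2]

/-- The bound on `|Dη|²` depends only on `x - y`, so integrating in `x` first yields a constant by
translation invariance and leaves `∫ u²`. -/
theorem IsWeight.lintegral_commutator_le {n : ℕ} {L : ℝ} {η : Rn n → ℝ} (hη : IsWeight L η)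
    (α : ℝ) {u : Rn n → ℝ} (hu : AEStronglyMeasurable u volume) :
    ∫⁻ z : Rn n × Rn n, ‖u z.2 * gag α η z‖ₑ ^ 2 ≤ kernelMass n α L * ∫⁻ y, ‖u y‖ₑ ^ 2 := by
  have h1 : ∫⁻ z : Rn n × Rn n, ‖u z.2 * gag α η z‖ₑ ^ 2
      ≤ ∫⁻ z : Rn n × Rn n, ‖u z.2‖ₑ ^ 2 * ENNReal.ofReal
        (min ((L * ‖z.1 - z.2‖) ^ 2) 1 / ‖z.1 - z.2‖ ^ ((n : ℝ) + 2 * α)) := by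
    refine lintegral_mono fun z => ?_
    rw [enorm_mul, mul_pow]
    refine mul_le_mul_right ?_ _
    rw [enorm_sq_eq_ofReal_sq]
    exact ENNReal.ofReal_le_ofReal (hη.gag_sq_le α z)
  refine h1.trans (le_of_eq ?_)
  have hm : AEMeasurable (fun z : Rn n × Rn n => ‖u z.2‖ₑ ^ 2 * ENNReal.ofReal
        (min ((L * ‖z.1 - z.2‖) ^ 2) 1 / ‖z.1 - z.2‖ ^ ((n : ℝ) + 2 * α)))
        ((volume : Measure (Rn n)).prod volume) := by
    exact (hu.comp_snd.enorm.pow_const 2).mul (by fun_prop)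
  rw [Measure.volume_eq_prod, lintegral_prod_symm _ hm]
  have h2 : ∀ y : Rn n, ∫⁻ x : Rn n, ‖u y‖ₑ ^ 2 * ENNReal.ofReal
        (min ((L * ‖x - y‖) ^ 2) 1 / ‖x - y‖ ^ ((n : ℝ) + 2 * α))
      = kernelMass n α L * ‖u y‖ₑ ^ 2 := by
    intro y
    rw [lintegral_const_mul _ (by fun_prop), mul_comm]
    congr 1
    exact lintegral_sub_right_eq_self (fun x : Rn n => ENNReal.ofReal
        (min ((L * ‖x‖) ^ 2) 1 / ‖x‖ ^ ((n : ℝ) + 2 * α))) y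
  simp_rw [h2]
  rw [lintegral_const_mul'' _ (hu.enorm.pow_const 2)]

theorem IsWeight.memLp_commutator {n : ℕ} {L : ℝ} {η : Rn n → ℝ} (hη : IsWeight L η)
    {α : ℝ} (h0 : 0 < α) (h1 : α < 1) {u : Rn n → ℝ} (hu : MemLp u 2 volume) :
    MemLp (fun z : Rn n × Rn n => u z.2 * gag α η z) 2 volume := by
  refine (memLp_two_iff_lintegral ?_).2 ?_
  · exact hu.1.comp_snd.mul (measurable_gag α hη.measurable).aestronglyMeasurable
  · exact (hη.lintegral_commutator_le α hu.1).trans_lt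
      (ENNReal.mul_lt_top (kernelMass_lt_top h0 h1 hη.L_nonneg hη.L_le_one)
        ((memLp_two_iff_lintegral hu.1).1 hu))

theorem IsWeight.memLp_mul {n : ℕ} {L : ℝ} {η : Rn n → ℝ} (hη : IsWeight L η) {Z : Type*}
    [MeasurableSpace Z] {μ : Measure Z} {φ : Z → Rn n} (hφ : Measurable φ) {q : ℝ≥0∞}
    {u : Z → ℝ} (hu : MemLp u q μ) : MemLp (fun z => η (φ z) * u z) q μ := by
  refine hu.mono ((hη.measurable.comp hφ).aestronglyMeasurable.mul hu.1) (ae_of_all _ fun z => ?_)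
  rw [norm_mul, Real.norm_eq_abs, abs_of_nonneg (hη.nonneg _)]
  exact mul_le_of_le_one_left (norm_nonneg _) (hη.le_one _)

theorem IsWeight.memLp_gag_mul {n : ℕ} {L : ℝ} {η : Rn n → ℝ} (hη : IsWeight L η)
    {α : ℝ} (h0 : 0 < α) (h1 : α < 1) {u : Rn n → ℝ} (hu : MemLp u 2 volume)
    (hg : MemLp (gag α u) 2 volume) : MemLp (gag α fun x => η x * u x) 2 volume := by
  have := (hη.memLp_mul measurable_fst hg).add (hη.memLp_commutator h0 h1 hu)
  refine this.congr_norm ?_ (ae_of_all _ fun z => ?_)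
  · exact aestronglyMeasurable_gag α (hη.measurable.aestronglyMeasurable.mul hu.1)
  · rw [gag_mul]
    rfl

/-- The form `∬ Du · D(ηu)` is nonnegative up to a small multiple of the energy. -/
theorem IsWeight.neg_le_integral_gag {n : ℕ} {L : ℝ} {η : Rn n → ℝ} (hη : IsWeight L η)
    {α : ℝ} (h0 : 0 < α) (h1 : α < 1) {u : Rn n → ℝ} (hu : MemLp u 2 volume)
    (hg : MemLp (gag α u) 2 volume) {μ : ℝ} (hμ : 0 < μ)
    (hL : kernelMass n α L ≤ ENNReal.ofReal (μ ^ 2)) :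
    -(μ / 2 * ((∫ z, gag α u z ^ 2) + ∫ x, u x ^ 2))
      ≤ ∫ z, gag α u z * gag α (fun x => η x * u x) z := by
  have hc := hη.memLp_commutator h0 h1 hu
  have hcsq : ∫ z : Rn n × Rn n, (u z.2 * gag α η z) ^ 2 ≤ μ ^ 2 * ∫ x, u x ^ 2 := by
    have a := hη.lintegral_commutator_le α hu.1
    have b : ∫⁻ z : Rn n × Rn n, ‖u z.2 * gag α η z‖ₑ ^ 2
        ≤ ENNReal.ofReal (μ ^ 2) * ∫⁻ y, ‖u y‖ₑ ^ 2 := a.trans (mul_le_mul_left hL _)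
    simp only [enorm_sq_eq_ofReal_sq] at b
    rw [← ofReal_integral_eq_lintegral_ofReal hc.integrable_sq (ae_of_all _ fun _ => sq_nonneg _),
      ← ofReal_integral_eq_lintegral_ofReal hu.integrable_sq (ae_of_all _ fun _ => sq_nonneg _),
      ← ENNReal.ofReal_mul (sq_nonneg _)] at b
    exact (ENNReal.ofReal_le_ofReal_iff (mul_nonneg (sq_nonneg _)
      (integral_nonneg fun _ => sq_nonneg _))).1 b
  have hlow : ∫ z, (-(μ / 2) * gag α u z ^ 2 + -(1 / (2 * μ)) * (u z.2 * gag α η z) ^ 2)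
      ≤ ∫ z, gag α u z * gag α (fun x => η x * u x) z := by
    refine integral_mono ((hg.integrable_sq.const_mul _).add (hc.integrable_sq.const_mul _))
      (hg.integrable_mul (hη.memLp_gag_mul h0 h1 hu hg)) fun z => ?_
    simp only
    rw [gag_mul]
    have e1 : 0 ≤ η z.1 * gag α u z ^ 2 := mul_nonneg (hη.nonneg _) (sq_nonneg _)
    set A := gag α u z
    set B := u z.2 * gag α η z
    -- Young's inequality `A B ≥ -(μ/2) A² - B²/(2μ)`. As the commutator satisfies `∫ B² ≤ μ² ∫ u²`,
    -- both errors carry the same factor `μ/2`.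
    have e2 : 0 ≤ 1 / (2 * μ) * (μ * A + B) ^ 2 := by positivity
    have e3 : 1 / (2 * μ) * (μ * A + B) ^ 2
        = μ / 2 * A ^ 2 + A * B + 1 / (2 * μ) * B ^ 2 := by field_simp; ring
    nlinarith
  rw [integral_add (hg.integrable_sq.const_mul _) (hc.integrable_sq.const_mul _),
    integral_const_mul, integral_const_mul] at hlow
  have : 1 / (2 * μ) * ∫ z : Rn n × Rn n, (u z.2 * gag α η z) ^ 2 ≤ μ / 2 * ∫ x, u x ^ 2 := by
    calc _ ≤ 1 / (2 * μ) * (μ ^ 2 * ∫ x, u x ^ 2) :=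
          mul_le_mul_of_nonneg_left hcsq (by positivity)
      _ = _ := by field_simp
  linarith

/-! ### The weighted energy identity for an abstract right-hand side -/

/-- Multiplication of an `L²` function by a weight. -/
noncomputable def weightMul {n : ℕ} {L : ℝ} {η : Rn n → ℝ} (hη : IsWeight L η) (u : H n) : H n :=
  (hη.memLp_mul measurable_id (Lp.memLp u)).toLp

theorem coeFn_weightMul {n : ℕ} {L : ℝ} {η : Rn n → ℝ} (hη : IsWeight L η) (u : H n) :
    weightMul hη u =ᵐ[volume] fun x => η x * u x :=
  MemLp.coeFn_toLp _

theorem continuous_weightMul {n : ℕ} {L : ℝ} {η : Rn n → ℝ} (hη : IsWeight L η) :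
    Continuous (weightMul hη : H n → H n) := by
  refine (LipschitzWith.of_dist_le_mul (K := 1) fun u w => ?_).continuous
  rw [dist_eq_norm, dist_eq_norm, NNReal.coe_one, one_mul]
  refine Lp.norm_le_norm_of_ae_le ?_
  filter_upwards [Lp.coeFn_sub u w, Lp.coeFn_sub (weightMul hη u) (weightMul hη w),
    coeFn_weightMul hη u, coeFn_weightMul hη w] with x h1 h2 h3 h4
  rw [h1, h2, Pi.sub_apply, Pi.sub_apply, h3, h4, ← mul_sub, norm_mul, Real.norm_eq_abs,
    abs_of_nonneg (hη.nonneg _)]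
  exact mul_le_of_le_one_left (norm_nonneg _) (hη.le_one _)

theorem inner_eq_integral_mul {n : ℕ} (u w : H n) : inner ℝ u w = ∫ x, u x * w x := by
  rw [L2.inner_def]
  congr 1
  ext x
  simp [mul_comm]

theorem inner_weightMul {n : ℕ} {L : ℝ} {η : Rn n → ℝ} (hη : IsWeight L η) (u w : H n) :
    inner ℝ u (weightMul hη w) = ∫ x, η x * (u x * w x) := by
  rw [inner_eq_integral_mul]
  refine integral_congr_ae ?_
  filter_upwards [coeFn_weightMul hη w] with x h
  rw [h]
  ring

theorem continuousOn_weighted_energy {n : ℕ} {L T : ℝ} {η : Rn n → ℝ} (hη : IsWeight L η)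
    {u : ℝ → H n} (hu : ContinuousOn u (Icc 0 T)) :
    ContinuousOn (fun s => ∫ x, η x * u s x ^ 2) (Icc 0 T) := by
  have : (fun s => ∫ x, η x * u s x ^ 2) = fun s => inner ℝ (u s) (weightMul hη (u s)) := by
    ext s
    rw [inner_weightMul]
    simp only [pow_two]
  rw [this]
  exact hu.inner ((continuous_weightMul hη).comp_continuousOn hu)

section

variable {Y : Type*} [NormedAddCommGroup Y] [NormedSpace ℝ Y] [FiniteDimensional ℝ Y]
  [MeasureSpace Y] [BorelSpace Y] [(volume : Measure Y).IsAddHaarMeasure]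

theorem integrableOn_pairing_const {p q : ℝ≥0∞} [ENNReal.HolderConjugate q p] {f : ℝ × Y → ℝ}
    {ξ : Y → ℝ} (hf : MemLp f q volume) (hξ : MemLp ξ p volume) (T : ℝ) :
    IntegrableOn (fun s => ∫ y, f (s, y) * ξ y) (Ioc 0 T) := by
  have h1 : MemLp f q ((volume.restrict (Ioc 0 T)).prod volume) :=
    hf.mono_measure (Measure.prod_mono Measure.restrict_le_self le_rfl)
  have h2 := hξ.comp_snd (volume.restrict (Ioc (0 : ℝ) T))
  exact (h1.integrable_mul h2).integral_prod_left

/-- Membership in `L^q` of a function on space-time, from its time slices. -/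
theorem memLp_of_slices {q : ℝ≥0∞} (hq0 : q ≠ 0) (hq : q ≠ ∞) {f : ℝ × Y → ℝ}
    (hf : Measurable f) {T : ℝ} (h0 : ∀ s ∉ Ioc 0 T, ∀ y, f (s, y) = 0)
    (h : ∫⁻ s in Ioc 0 T, ∫⁻ y, ‖f (s, y)‖ₑ ^ q.toReal < ∞) : MemLp f q volume := by
  refine ⟨hf.aestronglyMeasurable, ?_⟩
  rw [eLpNorm_lt_top_iff_lintegral_rpow_enorm_lt_top hq0 hq, Measure.volume_eq_prod,
    lintegral_prod _ (by fun_prop)]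
  refine lt_of_le_of_lt (le_of_eq ?_) h
  rw [← lintegral_indicator measurableSet_Ioc]
  congr 1
  ext s
  by_cases hs : s ∈ Ioc 0 T
  · rw [indicator_of_mem hs]
  · rw [indicator_of_notMem hs]
    simp [h0 s hs, ENNReal.toReal_pos hq0 hq]

end

/-- Allows `Y = Rn n × Rn n` in the pairing lemmas, the domain of difference quotients. -/
instance isAddHaarMeasure_volume_prod (n : ℕ) :
    (volume : Measure (Rn n × Rn n)).IsAddHaarMeasure :=
  inferInstanceAs (((volume : Measure (Rn n)).prod volume).IsAddHaarMeasure)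

/-- For almost every `s` the function `η u(s)` is an admissible test function, and subtracting the
weak form at two times gives `(u(b) - u(a), η u(s))` as an integral of the pairing kernel. Adding
the cases of test times `s` and `s'` produces the increment of the weighted energy, to which
`energy_identity_of_increments` applies. -/
theorem weighted_energy_identity {n : ℕ} {α L T : ℝ} {η : Rn n → ℝ} {p q : ℝ≥0∞}
    (hα₀ : 0 < α) (hα₁ : α < 1) (hη : IsWeight L η) [hpq : ENNReal.HolderConjugate q p]
    (hq : q ≠ ∞) {U Φ₂ Φq : ℝ × Rn n → ℝ} {u : ℝ → H n}
    (hU2 : MemLp U 2 volume) (hUp : MemLp U p volume)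
    (hUg : MemLp (fun z : ℝ × (Rn n × Rn n) => gag α (fun x => U (z.1, x)) z.2) 2 volume)
    (hUg' : MemLp (fun z : ℝ × (Rn n × Rn n) => gag α (fun x => η x * U (z.1, x)) z.2) 2 volume)
    (hΦ₂ : MemLp Φ₂ 2 volume) (hΦq : MemLp Φq q volume)
    (hu : ContinuousOn u (Icc 0 T))
    (hUu : ∀ᵐ s ∂volume.restrict (Ioc 0 T), (fun x => U (s, x)) =ᵐ[volume] u s)
    (hu2 : ∀ᵐ s ∂volume.restrict (Ioc 0 T), MemLp (gag α (u s)) 2 volume)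
    (hup : ∀ᵐ s ∂volume.restrict (Ioc 0 T), MemLp (u s) p volume) (c : ℝ)
    (hweak : ∀ ξ : H n, MemLp (gag α ξ) 2 volume → MemLp ξ p volume → ∀ t ∈ Icc 0 T,
      inner ℝ (u t) ξ - inner ℝ (u 0) ξ = ∫ s in (0 : ℝ)..t,
        (-c * (∫ z, gag α (fun x => U (s, x)) z * gag α ξ z)
          + ∫ x, Φ₂ (s, x) * ξ x) + ∫ x, Φq (s, x) * ξ x)
    {t : ℝ} (ht : t ∈ Icc 0 T) :
    IntegrableOn (fun s => (-c * (∫ z, gag α (fun x => U (s, x)) z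
            * gag α (fun x => η x * U (s, x)) z)
          + ∫ x, Φ₂ (s, x) * (η x * U (s, x))) + ∫ x, Φq (s, x) * (η x * U (s, x))) (Ioc 0 T) ∧
    (∫ x, η x * u t x ^ 2) - (∫ x, η x * u 0 x ^ 2) = 2 * ∫ s in (0 : ℝ)..t,
        ((-c * (∫ z, gag α (fun x => U (s, x)) z * gag α (fun x => η x * U (s, x)) z)
          + ∫ x, Φ₂ (s, x) * (η x * U (s, x))) + ∫ x, Φq (s, x) * (η x * U (s, x))) := by
  have hw2 : MemLp (fun z : ℝ × Rn n => η z.2 * U z) 2 volume := hη.memLp_mul measurable_snd hU2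
  have hwp : MemLp (fun z : ℝ × Rn n => η z.2 * U z) p volume := hη.memLp_mul measurable_snd hUp
  have d1 := (diagContinuous_pairing (p := 2) (q := 2) (by norm_num) hUg hUg' T).const_mul (-c)
  have d2 := diagContinuous_pairing (p := 2) (q := 2) (by norm_num) hΦ₂ hw2 T
  have d3 := diagContinuous_pairing (p := p) (q := q) hq hΦq hwp T
  have hP := (d1.add d2).add d3
  refine ⟨hP.diag.integrableOn, ?_⟩
  have hE : ContinuousOn (fun s => ∫ x, η x * u s x ^ 2) (Icc 0 T) :=
    continuousOn_weighted_energy hη hu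
  refine energy_identity_of_increments (G := {s | (fun x => U (s, x)) =ᵐ[volume] u s ∧
    MemLp (gag α (u s)) 2 volume ∧ MemLp (u s) p volume}) hP hE ?_ ?_ ht
  · filter_upwards [hUu, hu2, hup] with s h1 h2 h3 using ⟨h1, h2, h3⟩
  have key : ∀ s, (fun x => U (s, x)) =ᵐ[volume] u s → MemLp (gag α (u s)) 2 volume →
      MemLp (u s) p volume → ∀ a ∈ Icc 0 T, ∀ b ∈ Icc 0 T,
      (∫ x, η x * (u b x * u s x)) - (∫ x, η x * (u a x * u s x)) = ∫ r in a..b,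
        ((-c * (∫ z, gag α (fun x => U (r, x)) z * gag α (fun x => η x * U (s, x)) z)
          + ∫ x, Φ₂ (r, x) * (η x * U (s, x))) + ∫ x, Φq (r, x) * (η x * U (s, x))) := by
    intro s h1 h2 h3 a ha b hb
    have e1 : (fun x => η x * U (s, x)) =ᵐ[volume] weightMul hη (u s) := by
      filter_upwards [h1, coeFn_weightMul hη (u s)] with x a1 a2
      rw [a2, ← a1]
    have e2 := gag_congr_ae α e1
    have g1 : MemLp (gag α (weightMul hη (u s))) 2 volume :=
      (memLp_congr_ae (gag_congr_ae α (coeFn_weightMul hη (u s)))).2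
        (hη.memLp_gag_mul hα₀ hα₁ (Lp.memLp _) h2)
    have g2 : MemLp (weightMul hη (u s)) p volume :=
      (memLp_congr_ae (coeFn_weightMul hη (u s))).2 (hη.memLp_mul measurable_id h3)
    have hI : IntegrableOn (fun r => (-c * (∫ z, gag α (fun x => U (r, x)) z
          * gag α (weightMul hη (u s)) z)
          + ∫ x, Φ₂ (r, x) * weightMul hη (u s) x) + ∫ x, Φq (r, x) * weightMul hη (u s) x)
        (Ioc 0 T) :=
      (((integrableOn_pairing_const hUg g1 T).const_mul (-c)).add
        (integrableOn_pairing_const hΦ₂ (Lp.memLp _) T)).add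
        (integrableOn_pairing_const hΦq g2 T)
    have hII : ∀ x ∈ Icc 0 T, IntervalIntegrable (fun r => (-c * (∫ z, gag α (fun x => U (r, x)) z
          * gag α (weightMul hη (u s)) z)
          + ∫ x, Φ₂ (r, x) * weightMul hη (u s) x) + ∫ x, Φq (r, x) * weightMul hη (u s) x)
        volume 0 x := fun x hx =>
      (intervalIntegrable_iff_integrableOn_Ioc_of_le hx.1).2
        (hI.mono_set (Ioc_subset_Ioc_right hx.2))
    have w1 := hweak _ g1 g2 a ha
    have w2 := hweak _ g1 g2 b hb
    have w3 := intervalIntegral.integral_interval_sub_left (hII b hb) (hII a ha)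
    rw [← w1, ← w2, inner_weightMul, inner_weightMul, inner_weightMul] at w3
    have i1 : ∀ r, ∫ z, gag α (fun x => U (r, x)) z * gag α (fun x => η x * U (s, x)) z
        = ∫ z, gag α (fun x => U (r, x)) z * gag α (weightMul hη (u s)) z := fun r =>
      integral_congr_ae (by filter_upwards [e2] with z hz; rw [hz])
    have i2 : ∀ r, ∫ x, Φ₂ (r, x) * (η x * U (s, x)) = ∫ x, Φ₂ (r, x) * weightMul hη (u s) x :=
      fun r => integral_congr_ae (by filter_upwards [e1] with z hz; rw [hz])
    have i3 : ∀ r, ∫ x, Φq (r, x) * (η x * U (s, x)) = ∫ x, Φq (r, x) * weightMul hη (u s) x :=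
      fun r => integral_congr_ae (by filter_upwards [e1] with z hz; rw [hz])
    simp_rw [i1, i2, i3]
    rw [← w3]
    ring
  rintro s ⟨⟨s1, s2, s3⟩, hs⟩ s' ⟨⟨t1, t2, t3⟩, hs'⟩ hle
  have k1 := key s' t1 t2 t3 s (Ioc_subset_Icc_self hs) s' (Ioc_subset_Icc_self hs')
  have k2 := key s s1 s2 s3 s (Ioc_subset_Icc_self hs) s' (Ioc_subset_Icc_self hs')
  rw [← k1, ← k2]
  -- By symmetry the mixed terms cancel.
  have e : ∫ x, η x * (u s' x * u s x) = ∫ x, η x * (u s x * u s' x) := by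
    congr 1; ext x; ring
  rw [e]
  simp only [pow_two]
  ring

/-! ### Bounds and measurability of the coefficients -/

/-- The sum is the `l²` inner product of `w` with `τ + k₀ σ₂`, so Cauchy–Schwarz applies; the
constants are the `l²` norms of the growth sequences. -/
theorem DiffusionCondition.exists_bound {n : ℕ} {κ : Rn n → ℝ}
    {σ₁ : ℝ → Lp Ell2 2 (volume : Measure (Rn n))} {σ₂ : ℕ → ℝ → Rn n → ℝ → ℝ} {a b c : ℕ → ℝ}
    (hσ : DiffusionCondition κ σ₁ σ₂ a b c) :
    ∃ B C : ℝ, 0 ≤ B ∧ 0 ≤ C ∧ ∀ (τ w : Ell2) (k₀ t : ℝ) (x : Rn n) (s : ℝ),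
      |∑' k, (τ k + k₀ * σ₂ k t x s) * w k| ≤ (‖τ‖ + |k₀| * (B + C * |s|)) * ‖w‖ := by
  have hb : Memℓp b 2 := by
    refine memℓp_gen (hσ.summable.of_nonneg_of_le (fun k => by positivity) fun k => ?_)
    simp only [ENNReal.toReal_ofNat, Real.rpow_ofNat, Real.norm_eq_abs, sq_abs]
    nlinarith [sq_nonneg (a k), sq_nonneg (c k)]
  have hc : Memℓp c 2 := by
    refine memℓp_gen (hσ.summable.of_nonneg_of_le (fun k => by positivity) fun k => ?_)
    simp only [ENNReal.toReal_ofNat, Real.rpow_ofNat, Real.norm_eq_abs, sq_abs]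
    nlinarith [sq_nonneg (a k), sq_nonneg (b k)]
  let b' : Ell2 := ⟨b, hb⟩
  let c' : Ell2 := ⟨c, hc⟩
  refine ⟨‖b'‖, ‖c'‖, norm_nonneg _, norm_nonneg _, fun τ w k₀ t x s => ?_⟩
  let e : Ell2 := b' + |s| • c'
  have he : ∀ k, |σ₂ k t x s| ≤ ‖e k‖ := by
    intro k
    have h1 : e k = b k + |s| * c k := rfl
    rw [h1, Real.norm_eq_abs, mul_comm]
    exact (hσ.sigma₂_growth k t x s).trans (le_abs_self _)
  have hz : Memℓp (fun k => σ₂ k t x s) 2 := by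
    have h2 := (memℓp_gen_iff (p := 2) (by norm_num)).1 (lp.memℓp e)
    refine memℓp_gen (h2.of_nonneg_of_le (fun k => by positivity) fun k => ?_)
    exact Real.rpow_le_rpow (norm_nonneg _) (he k) (by norm_num)
  let z : Ell2 := ⟨fun k => σ₂ k t x s, hz⟩
  have hze : ‖z‖ ≤ ‖b'‖ + ‖c'‖ * |s| := by
    calc ‖z‖ ≤ ‖e‖ := lp.norm_mono (by norm_num) he
      _ ≤ ‖b'‖ + ‖|s| • c'‖ := norm_add_le _ _
      _ = _ := by rw [norm_smul, Real.norm_eq_abs, abs_abs, mul_comm]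
  have hi : ∑' k, (τ k + k₀ * σ₂ k t x s) * w k = inner ℝ w (τ + k₀ • z) := by
    rw [lp.inner_eq_tsum]
    rfl
  rw [hi]
  calc |inner ℝ w (τ + k₀ • z)| ≤ ‖w‖ * ‖τ + k₀ • z‖ := abs_real_inner_le_norm _ _
    _ ≤ ‖w‖ * (‖τ‖ + |k₀| * (‖b'‖ + ‖c'‖ * |s|)) := by
        refine mul_le_mul_of_nonneg_left ((norm_add_le _ _).trans ?_) (norm_nonneg _)
        rw [norm_smul, Real.norm_eq_abs]
        exact add_le_add le_rfl (mul_le_mul_of_nonneg_left hze (abs_nonneg _))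
    _ = _ := mul_comm _ _

theorem continuous_ell2_apply (k : ℕ) : Continuous fun f : Ell2 => f k := by
  refine (LipschitzWith.of_dist_le_mul (K := 1) fun f g => ?_).continuous
  rw [dist_eq_norm, dist_eq_norm, NNReal.coe_one, one_mul]
  exact lp.norm_apply_le_norm (by norm_num) (f - g) k

/-- Each component of `σ₂` is a Carathéodory function, measurable in `(t, x)` and Lipschitz in `s`,
hence jointly measurable. -/
theorem DiffusionCondition.measurable_tsum {n : ℕ} {κ κ' : Rn n → ℝ}
    {σ₁ : ℝ → Lp Ell2 2 (volume : Measure (Rn n))} {σ₂ : ℕ → ℝ → Rn n → ℝ → ℝ} {a b c : ℕ → ℝ}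
    (hσ : DiffusionCondition κ σ₁ σ₂ a b c) (hκ : Measurable κ') {S₁ : ℝ × Rn n → Ell2}
    (hS₁ : StronglyMeasurable S₁) {v : ℝ → Ell2} (hv : StronglyMeasurable v)
    {U : ℝ × Rn n → ℝ} (hU : Measurable U) :
    Measurable fun z : ℝ × Rn n =>
      ∑' k, (S₁ z k + κ' z.2 * σ₂ k z.1 z.2 (U z)) * v z.1 k := by
  refine Measurable.tsum fun k => ?_
  have h1 : Measurable fun z => S₁ z k :=
    ((continuous_ell2_apply k).comp_stronglyMeasurable hS₁).measurable
  have h2 : Measurable fun z : ℝ × Rn n => v z.1 k :=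
    ((continuous_ell2_apply k).comp_stronglyMeasurable hv).measurable.comp measurable_fst
  have h3 : Measurable (Function.uncurry fun (s : ℝ) (z : ℝ × Rn n) => σ₂ k z.1 z.2 s) := by
    refine measurable_uncurry_of_continuous_of_measurable (fun z => ?_) fun s => hσ.sigma₂_meas k s
    refine (LipschitzWith.of_dist_le_mul (K := (a k).toNNReal) fun r s => ?_).continuous
    rw [Real.coe_toNNReal _ (hσ.a_pos k).le]
    exact hσ.sigma₂_lip k z.1 z.2 r s
  have h4 : Measurable fun z : ℝ × Rn n => σ₂ k z.1 z.2 (U z) := h3.comp (hU.prodMk measurable_id)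
  exact (h1.add ((hκ.comp measurable_snd).mul h4)).mul h2

theorem DriftCondition.abs_le {n : ℕ} {p lam₁ lam₂ : ℝ} {F : ℝ → Rn n → ℝ → ℝ}
    {ψ₁ ψ₂ ψ₃ : ℝ → Rn n → ℝ} (hF : DriftCondition p lam₁ lam₂ F ψ₁ ψ₂ ψ₃) (t : ℝ) (x : Rn n)
    (r : ℝ) : |F t x r| ≤ lam₂ * (ψ₂ t x + |r| ^ (p - 2)) * |r| := by
  have h := hF.lipschitz t x r 0
  have hp := hF.two_lt
  rw [hF.zero, abs_zero, Real.zero_rpow (by linarith)] at h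
  simpa using h

theorem lintegral_enorm_sq_eq {X E : Type*} [MeasurableSpace X] [NormedAddCommGroup E]
    {μ : Measure X} (f : X → E) : ∫⁻ x, ‖f x‖ₑ ^ (2 : ℝ≥0∞).toReal ∂μ = eLpNorm f 2 μ ^ 2 := by
  rw [eLpNorm_eq_lintegral_rpow_enorm_toReal (by norm_num) (by norm_num), ← ENNReal.rpow_natCast,
    ← ENNReal.rpow_mul]
  norm_num

/-- `U` is a measurable function on space-time that represents `u` on `(0,T]` and vanishes
outside. -/
structure Represents {n : ℕ} (T : ℝ) (u : ℝ → H n) (U : ℝ × Rn n → ℝ) : Prop where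
  measurable : Measurable U
  zero : ∀ s ∉ Ioc 0 T, ∀ x, U (s, x) = 0
  ae_eq : ∀ᵐ s ∂volume.restrict (Ioc 0 T), (fun x => U (s, x)) =ᵐ[volume] u s

theorem exists_represents {n : ℕ} {T : ℝ} {u : ℝ → H n}
    (hu : AEStronglyMeasurable u (volume.restrict (Ioc 0 T))) :
    ∃ U, Represents T u U := by
  obtain ⟨V, hV, hVu⟩ := exists_joint_representative hu.stronglyMeasurable_mk
  refine ⟨(Ioc 0 T ×ˢ univ).indicator V,
    hV.measurable.indicator (measurableSet_Ioc.prod MeasurableSet.univ), fun s hs x => ?_, ?_⟩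
  · exact indicator_of_notMem (fun h => hs h.1) _
  · filter_upwards [hu.ae_eq_mk, ae_restrict_mem measurableSet_Ioc] with s h1 h2
    filter_upwards [hVu s] with x hx
    rw [indicator_of_mem (show (s, x) ∈ Ioc 0 T ×ˢ univ from ⟨h2, mem_univ _⟩), hx, h1]

theorem Represents.lintegral_eq {n : ℕ} {T : ℝ} {u : ℝ → H n} {U : ℝ × Rn n → ℝ}
    (hU : Represents T u U) (φ : ℝ → ℝ≥0∞) :
    ∫⁻ s in Ioc 0 T, ∫⁻ x, φ (U (s, x)) = ∫⁻ s in Ioc 0 T, ∫⁻ x, φ (u s x) := by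
  refine lintegral_congr_ae ?_
  filter_upwards [hU.ae_eq] with s hs
  refine lintegral_congr_ae ?_
  filter_upwards [hs] with x hx
  rw [hx]

theorem Represents.memLp_two {n : ℕ} {T : ℝ} {u : ℝ → H n} {U : ℝ × Rn n → ℝ}
    (hU : Represents T u U) (h : ∫⁻ s in Ioc 0 T, ∫⁻ x, ‖u s x‖ₑ ^ 2 < ∞) :
    MemLp U 2 volume := by
  refine memLp_of_slices (by norm_num) (by norm_num) hU.measurable hU.zero ?_
  simp only [ENNReal.toReal_ofNat, ENNReal.rpow_ofNat]
  rwa [hU.lintegral_eq fun r => ‖r‖ₑ ^ 2]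

theorem Represents.memLp {n : ℕ} {T p : ℝ} {u : ℝ → H n} {U : ℝ × Rn n → ℝ}
    (hU : Represents T u U) (hp : 0 < p)
    (h : ∫⁻ s in Ioc 0 T, eLpNorm (u s) (ENNReal.ofReal p) volume ^ p < ∞) :
    MemLp U (ENNReal.ofReal p) volume := by
  refine memLp_of_slices (by simpa using hp) ENNReal.ofReal_ne_top hU.measurable hU.zero ?_
  rw [ENNReal.toReal_ofReal hp.le, hU.lintegral_eq fun r => ‖r‖ₑ ^ p]
  refine lt_of_le_of_lt (le_of_eq ?_) h
  congr 1
  ext s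
  rw [eLpNorm_eq_lintegral_rpow_enorm_toReal (by simpa using hp) ENNReal.ofReal_ne_top,
    ENNReal.toReal_ofReal hp.le, ← ENNReal.rpow_mul, one_div_mul_cancel hp.ne', ENNReal.rpow_one]

theorem Represents.memLp_gag {n : ℕ} {T α : ℝ} {u : ℝ → H n} {U : ℝ × Rn n → ℝ}
    (hU : Represents T u U) (h : ∫⁻ s in Ioc 0 T, ∫⁻ z, ‖gag α (u s) z‖ₑ ^ 2 < ∞) :
    MemLp (fun z : ℝ × (Rn n × Rn n) => gag α (fun x => U (z.1, x)) z.2) 2 volume := by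
  have hm := hU.measurable
  refine memLp_of_slices (T := T) (by norm_num) (by norm_num) ?_ (fun s hs z => ?_) ?_
  · unfold gag
    fun_prop
  · simp [gag, hU.zero s hs]
  · simp only [ENNReal.toReal_ofNat, ENNReal.rpow_ofNat]
    refine lt_of_le_of_lt (le_of_eq ?_) h
    refine lintegral_congr_ae ?_
    filter_upwards [hU.ae_eq] with s hs
    refine lintegral_congr_ae ?_
    filter_upwards [gag_congr_ae α hs] with x hx
    rw [hx]

theorem Represents.memLp_gag_mul {n : ℕ} {T α L : ℝ} {u : ℝ → H n} {U : ℝ × Rn n → ℝ}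
    {η : Rn n → ℝ} (h0 : 0 < α) (h1 : α < 1) (hη : IsWeight L η)
    (hU : Represents T u U) (h : ∫⁻ s in Ioc 0 T, ∫⁻ z, ‖gag α (u s) z‖ₑ ^ 2 < ∞)
    (h2 : ∫⁻ s in Ioc 0 T, ∫⁻ x, ‖u s x‖ₑ ^ 2 < ∞) :
    MemLp (fun z : ℝ × (Rn n × Rn n) => gag α (fun x => η x * U (z.1, x)) z.2) 2 volume := by
  have hm := hU.measurable
  have hm' := measurable_gag α hη.measurable
  have c1 := hη.memLp_mul (φ := fun z : ℝ × (Rn n × Rn n) => z.2.1) (by fun_prop) (hU.memLp_gag h)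
  have c2 : MemLp (fun z : ℝ × (Rn n × Rn n) => U (z.1, z.2.2) * gag α η z.2) 2 volume := by
    refine memLp_of_slices (T := T) (by norm_num) (by norm_num) (by fun_prop)
      (fun s hs z => by simp [hU.zero s hs]) ?_
    simp only [ENNReal.toReal_ofNat, ENNReal.rpow_ofNat]
    have hle : ∫⁻ s in Ioc 0 T, ∫⁻ z : Rn n × Rn n, ‖U (s, z.2) * gag α η z‖ₑ ^ 2
        ≤ ∫⁻ s in Ioc 0 T, kernelMass n α L * ∫⁻ x, ‖U (s, x)‖ₑ ^ 2 :=
      lintegral_mono fun s => hη.lintegral_commutator_le α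
        (u := fun x => U (s, x)) (by fun_prop : Measurable _).aestronglyMeasurable
    refine hle.trans_lt ?_
    rw [lintegral_const_mul' _ _ (kernelMass_lt_top h0 h1 hη.L_nonneg hη.L_le_one).ne,
      hU.lintegral_eq fun r => ‖r‖ₑ ^ 2]
    exact ENNReal.mul_lt_top (kernelMass_lt_top h0 h1 hη.L_nonneg hη.L_le_one) h2
  have c3 := c1.add c2
  have e : (fun z : ℝ × (Rn n × Rn n) => gag α (fun x => η x * U (z.1, x)) z.2)
      = (fun z : ℝ × (Rn n × Rn n) => η z.2.1 * gag α (fun x => U (z.1, x)) z.2)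
        + fun z : ℝ × (Rn n × Rn n) => U (z.1, z.2.2) * gag α η z.2 := by
    ext z
    exact gag_mul α η (fun x => U (z.1, x)) z.2
  rwa [e]

theorem exists_ae_abs_le_of_memLp_top {X : Type*} [MeasurableSpace X] {μ : Measure X} {f : X → ℝ}
    (hf : MemLp f ∞ μ) : ∃ N : ℝ, 0 ≤ N ∧ ∀ᵐ x ∂μ, |f x| ≤ N := by
  have h := hf.2.ne
  rw [eLpNorm_exponent_top] at h
  refine ⟨(eLpNormEssSup f μ).toReal, ENNReal.toReal_nonneg, ?_⟩
  filter_upwards [ae_le_eLpNormEssSup (f := f) (μ := μ)] with x hx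
  have := ENNReal.toReal_mono h hx
  simpa using this

section Drift

variable {n : ℕ} {p lam₁ lam₂ T : ℝ} {F : ℝ → Rn n → ℝ → ℝ}
  {ψ₁ ψ₂ ψ₃ : ℝ → Rn n → ℝ}

theorem DriftCondition.measurable_comp (hF : DriftCondition p lam₁ lam₂ F ψ₁ ψ₂ ψ₃)
    {U : ℝ × Rn n → ℝ} (hU : Measurable U) : Measurable fun z : ℝ × Rn n => F z.1 z.2 (U z) :=
  hF.cont.measurable.comp
    (measurable_fst.prodMk (measurable_snd.prodMk hU) : Measurable fun z : ℝ × Rn n =>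
      (z.1, z.2, U z))

/-- Since `F(t, x, 0) = 0` and `U` vanishes outside `(0, T]`, the essential bound of `ψ₂` on `[0,
T]` serves on all of space-time. -/
theorem DriftCondition.exists_ae_bound (hF : DriftCondition p lam₁ lam₂ F ψ₁ ψ₂ ψ₃) (T : ℝ) :
    ∃ N : ℝ, 0 ≤ N ∧ ∀ U : ℝ × Rn n → ℝ, (∀ s ∉ Ioc 0 T, ∀ x, U (s, x) = 0) →
      ∀ᵐ z : ℝ × Rn n, |F z.1 z.2 (U z)| ≤ lam₂ * (N + |U z| ^ (p - 2)) * |U z| := by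
  obtain ⟨N, hN, hb⟩ := exists_ae_abs_le_of_memLp_top (hF.psi₂_Linf 0 T)
  refine ⟨N, hN, fun U hU => ?_⟩
  rw [ae_restrict_iff' (measurableSet_Icc.prod MeasurableSet.univ)] at hb
  filter_upwards [hb] with z hz
  by_cases hs : z.1 ∈ Ioc 0 T
  · refine (hF.abs_le z.1 z.2 (U z)).trans ?_
    have h1 := hz ⟨Ioc_subset_Icc_self hs, mem_univ _⟩
    have h2 := hF.lam₂_pos
    have h3 := (le_abs_self _).trans h1
    gcongr
  · have h0 : U z = 0 := hU z.1 hs z.2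
    rw [h0, hF.zero]
    simp

/-- The part of the drift where the solution is small is square integrable. -/
theorem DriftCondition.memLp_small (hF : DriftCondition p lam₁ lam₂ F ψ₁ ψ₂ ψ₃)
    {U : ℝ × Rn n → ℝ} (hU : Measurable U) (h0 : ∀ s ∉ Ioc 0 T, ∀ x, U (s, x) = 0)
    (h2 : MemLp U 2 volume) :
    MemLp ({z | |U z| ≤ 1}.indicator fun z : ℝ × Rn n => F z.1 z.2 (U z)) 2 volume := by
  obtain ⟨N, hN, hb⟩ := hF.exists_ae_bound T
  have hset : MeasurableSet {z | |U z| ≤ 1} := measurableSet_le hU.abs measurable_const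
  refine h2.of_le_mul (c := lam₂ * (N + 1))
    ((hF.measurable_comp hU).indicator hset).aestronglyMeasurable ?_
  have hl := hF.lam₂_pos
  have hp := hF.two_lt
  filter_upwards [hb U h0] with z hz
  by_cases h : z ∈ {z | |U z| ≤ 1}
  · rw [indicator_of_mem h]
    refine hz.trans ?_
    have : |U z| ^ (p - 2) ≤ 1 := Real.rpow_le_one (abs_nonneg _) h (by linarith)
    rw [Real.norm_eq_abs]
    gcongr
  · rw [indicator_of_notMem h, norm_zero]
    positivity

/-- The part of the drift where the solution is large lies in the dual of `L^p`. -/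
theorem DriftCondition.memLp_large (hF : DriftCondition p lam₁ lam₂ F ψ₁ ψ₂ ψ₃)
    {U : ℝ × Rn n → ℝ} (hU : Measurable U) (h0 : ∀ s ∉ Ioc 0 T, ∀ x, U (s, x) = 0)
    (hpU : MemLp U (ENNReal.ofReal p) volume) :
    MemLp ({z | |U z| ≤ 1}ᶜ.indicator fun z : ℝ × Rn n => F z.1 z.2 (U z))
      (ENNReal.ofReal (p / (p - 1))) volume := by
  obtain ⟨N, hN, hb⟩ := hF.exists_ae_bound T
  have hset : MeasurableSet {z | |U z| ≤ 1} := measurableSet_le hU.abs measurable_const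
  have hl := hF.lam₂_pos
  have hp := hF.two_lt
  -- `|U|^(p-1)` lies in `L^(p/(p-1))`, and where `|U| > 1` it dominates the linear term `N |U|` as
  -- well.
  have hpow := hpU.norm_rpow_div (ENNReal.ofReal (p - 1))
  rw [← ENNReal.ofReal_div_of_pos (by linarith), ENNReal.toReal_ofReal (by linarith)] at hpow
  refine hpow.of_le_mul (c := lam₂ * (N + 1))
    ((hF.measurable_comp hU).indicator hset.compl).aestronglyMeasurable ?_
  filter_upwards [hb U h0] with z hz
  by_cases h : z ∈ {z | |U z| ≤ 1}
  · rw [indicator_of_notMem (not_not_intro h), norm_zero]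
    positivity
  · rw [indicator_of_mem h]
    refine hz.trans ?_
    have h1 : 1 ≤ |U z| := (not_le.1 h).le
    have h2 : 1 ≤ |U z| ^ (p - 2) := Real.one_le_rpow h1 (by linarith)
    have h3 : |U z| ^ (p - 1) = |U z| ^ (p - 2) * |U z| := by
      rw [← Real.rpow_add_one (by linarith)]
      congr 1
      ring
    rw [Real.norm_eq_abs, Real.norm_eq_abs, abs_of_nonneg (by positivity : 0 ≤ |U z| ^ (p - 1)),
      h3, ← mul_assoc]
    refine mul_le_mul_of_nonneg_right ?_ (abs_nonneg _)
    rw [mul_assoc]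
    refine mul_le_mul_of_nonneg_left ?_ hl.le
    nlinarith

end Drift

/-! ### The forcing terms -/

theorem exists_represents_forcing {n : ℕ} {T : ℝ} {g : ℝ → H n}
    (hg : MemLp g 2 (volume.restrict (Ioc 0 T))) :
    ∃ G, Represents T g G ∧ MemLp G 2 volume := by
  obtain ⟨G, hG⟩ := exists_represents hg.1
  refine ⟨G, hG, hG.memLp_two ?_⟩
  have h := hg.2
  rw [eLpNorm_lt_top_iff_lintegral_rpow_enorm_lt_top (by norm_num) (by norm_num)] at h
  refine lt_of_le_of_lt (le_of_eq ?_) h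
  congr 1
  ext s
  have := lintegral_enorm_sq_eq (μ := (volume : Measure (Rn n))) (g s)
  simp only [ENNReal.toReal_ofNat, ENNReal.rpow_ofNat] at this ⊢
  rw [this, Lp.enorm_def]

/-- The noise term as a function on space-time, cut off outside `(0,T]`. -/
noncomputable def noiseFun {n : ℕ} (T : ℝ) (κ : Rn n → ℝ) (S₁ : ℝ × Rn n → Ell2)
    (σ₂ : ℕ → ℝ → Rn n → ℝ → ℝ) (v : ℝ → Ell2) (U : ℝ × Rn n → ℝ) : ℝ × Rn n → ℝ :=
  (Ioc 0 T ×ˢ univ).indicator fun z =>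
    ∑' k, (S₁ z k + κ z.2 * σ₂ k z.1 z.2 (U z)) * v z.1 k

section Noise

variable {n : ℕ} {T : ℝ} {κ κ' : Rn n → ℝ} {σ₁ : ℝ → Lp Ell2 2 (volume : Measure (Rn n))}
  {σ₂ : ℕ → ℝ → Rn n → ℝ → ℝ} {a b c : ℕ → ℝ} {S₁ : ℝ × Rn n → Ell2}

/-- At time `s` the spatial `L²` norm is at most `‖v s‖` times a constant `K`, by compactness of
`[0, T]` and continuity of `σ₁` and `u`. Membership `κ ∈ L²` handles the constant growth of `σ₂`,
and `κ ∈ L^∞` its linear growth. -/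
theorem memLp_noiseFun (hσ : DiffusionCondition κ σ₁ σ₂ a b c) (hκm : Measurable κ')
    (hκ : κ' =ᵐ[volume] κ) (hS : StronglyMeasurable S₁)
    (hS₁ : ∀ t, (fun x => S₁ (t, x)) =ᵐ[volume] σ₁ t) {v : ℝ → Ell2} (hv : StronglyMeasurable v)
    (hv2 : ∫⁻ s in Ioc 0 T, ‖v s‖ₑ ^ 2 < ∞) {u : ℝ → H n} {U : ℝ × Rn n → ℝ}
    (hU : Represents T u U) (hu : ContinuousOn u (Icc 0 T)) :
    MemLp (noiseFun T κ' S₁ σ₂ v U) 2 volume := by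
  obtain ⟨B, C, hB, hC, hbound⟩ := hσ.exists_bound
  obtain ⟨N, hN, hκN⟩ := exists_ae_abs_le_of_memLp_top hσ.kappa_Linf
  have hm := hσ.measurable_tsum hκm hS hv hU.measurable
  have hset : MeasurableSet (Ioc 0 T ×ˢ (univ : Set (Rn n))) :=
    measurableSet_Ioc.prod MeasurableSet.univ
  obtain ⟨M₁, hM₁⟩ := isCompact_Icc.exists_bound_of_continuousOn
    (hσ.sigma₁_cont.continuousOn (s := Icc 0 T))
  obtain ⟨M₂, hM₂⟩ := isCompact_Icc.exists_bound_of_continuousOn hu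
  set K : ℝ≥0∞ := ENNReal.ofReal M₁ + eLpNorm (fun x => B * κ x) 2 volume
    + ENNReal.ofReal (N * C) * ENNReal.ofReal M₂ with hK
  have hKtop : K < ∞ := by
    have := (hσ.kappa_L2.const_mul B).2
    simp only [hK, ENNReal.add_lt_top]
    exact ⟨⟨ENNReal.ofReal_lt_top, this⟩,
      ENNReal.mul_lt_top ENNReal.ofReal_lt_top ENNReal.ofReal_lt_top⟩
  refine memLp_of_slices (T := T) (by norm_num) (by norm_num) (hm.indicator hset)
    (fun s hs x => indicator_of_notMem (fun h => hs h.1) _) ?_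
  have key : ∀ᵐ s ∂volume.restrict (Ioc 0 T),
      ∫⁻ x, ‖noiseFun T κ' S₁ σ₂ v U (s, x)‖ₑ ^ (2 : ℝ≥0∞).toReal ≤ ‖v s‖ₑ ^ 2 * K ^ 2 := by
    filter_upwards [hU.ae_eq, ae_restrict_mem measurableSet_Ioc] with s h1 hs
    rw [lintegral_enorm_sq_eq fun x => noiseFun T κ' S₁ σ₂ v U (s, x), ← mul_pow]
    refine pow_le_pow_left' ?_ 2
    have hle : ∀ᵐ x : Rn n, ‖noiseFun T κ' S₁ σ₂ v U (s, x)‖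
        ≤ ‖v s‖ * ‖‖σ₁ s x‖ + ‖B * κ x‖ + N * C * ‖u s x‖‖ := by
      filter_upwards [h1, hκ, hκN, hS₁ s] with x a1 a2 a3 a4
      rw [noiseFun, indicator_of_mem (show (s, x) ∈ Ioc 0 T ×ˢ univ from ⟨hs, mem_univ _⟩)]
      refine (hbound (S₁ (s, x)) (v s) (κ' x) s x (U (s, x))).trans ?_
      rw [mul_comm, a4, a2, a1]
      refine mul_le_mul_of_nonneg_left ?_ (norm_nonneg _)
      rw [Real.norm_of_nonneg
        (by positivity : 0 ≤ ‖σ₁ s x‖ + ‖B * κ x‖ + N * C * ‖u s x‖),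
        Real.norm_eq_abs, Real.norm_eq_abs, abs_mul, abs_of_nonneg hB]
      have : |κ x| * (C * |u s x|) ≤ N * (C * |u s x|) :=
        mul_le_mul_of_nonneg_right a3 (by positivity)
      nlinarith
    refine (eLpNorm_le_mul_eLpNorm_of_ae_le_mul hle 2).trans ?_
    rw [ofReal_norm]
    refine mul_le_mul_right ?_ _
    have m1 : AEStronglyMeasurable (fun x => ‖σ₁ s x‖) volume := (Lp.aestronglyMeasurable _).norm
    have m2 : AEStronglyMeasurable (fun x => ‖B * κ x‖) volume :=
      (hσ.kappa_L2.const_mul B).1.norm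
    have m3 : AEStronglyMeasurable (fun x => N * C * ‖u s x‖) volume :=
      (Lp.aestronglyMeasurable _).norm.const_mul _
    refine (eLpNorm_add_le (m1.add m2) m3 (by norm_num)).trans ?_
    refine add_le_add ((eLpNorm_add_le m1 m2 (by norm_num)).trans (add_le_add ?_ ?_)) ?_
    · rw [eLpNorm_norm, ← Lp.enorm_def, ← ofReal_norm]
      exact ENNReal.ofReal_le_ofReal (hM₁ s (Ioc_subset_Icc_self hs))
    · rw [eLpNorm_norm]
    · refine (eLpNorm_const_smul_le (c := N * C) (f := fun x => ‖u s x‖)).trans ?_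
      rw [eLpNorm_norm, ← Lp.enorm_def, Real.enorm_eq_ofReal (by positivity), ← ofReal_norm (u s)]
      exact mul_le_mul_right (ENNReal.ofReal_le_ofReal (hM₂ s (Ioc_subset_Icc_self hs))) _
  refine (lintegral_mono_ae key).trans_lt ?_
  rw [lintegral_mul_const' _ _ (ENNReal.pow_lt_top hKtop).ne]
  exact ENNReal.mul_lt_top hv2 (ENNReal.pow_lt_top hKtop)

theorem noiseFun_ae_eq (hκ : κ' =ᵐ[volume] κ)
    (hS₁ : ∀ t, (fun x => S₁ (t, x)) =ᵐ[volume] σ₁ t) {v : ℝ → Ell2}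
    {u : ℝ → H n} {U : ℝ × Rn n → ℝ} {s : ℝ} (hs : s ∈ Ioc 0 T)
    (hU : (fun x => U (s, x)) =ᵐ[volume] u s) :
    (fun x => noiseFun T κ' S₁ σ₂ v U (s, x)) =ᵐ[volume]
      sigmaOp κ σ₁ σ₂ s (u s) (v s) := by
  filter_upwards [hκ, hS₁ s, hU] with x a1 a2 a3
  rw [noiseFun, indicator_of_mem (show (s, x) ∈ Ioc 0 T ×ˢ univ from ⟨hs, mem_univ _⟩), sigmaOp,
    a1, a2, a3]

end Noise

/-! ### The weak formulation on space-time. -/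

theorem integral_neg_add_add {X : Type*} [MeasurableSpace X] {μ : Measure X} {f₁ f₂ f₃ : X → ℝ}
    (h₁ : Integrable f₁ μ) (h₂ : Integrable f₂ μ) (h₃ : Integrable f₃ μ) :
    ∫ x, (-f₁ x + f₂ x + f₃ x) ∂μ = -(∫ x, f₁ x ∂μ) + (∫ x, f₂ x ∂μ) + ∫ x, f₃ x ∂μ := by
  rw [integral_add (f := fun x => -f₁ x + f₂ x) (h₁.neg.add h₂) h₃,
    integral_add (f := fun x => -f₁ x) h₁.neg h₂, integral_neg]

theorem integral_mul_add_neg_add_add {X : Type*} [MeasurableSpace X] {μ : Measure X}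
    {f₀ f₁ f₂ f₃ f₄ : X → ℝ} (c : ℝ) (h₀ : Integrable f₀ μ)
    (h₁ : Integrable f₁ μ) (h₂ : Integrable f₂ μ) (h₃ : Integrable f₃ μ) (h₄ : Integrable f₄ μ) :
    ∫ x, (c * f₀ x + ((-f₁ x + f₂ x + f₃ x) + -f₄ x)) ∂μ = c * (∫ x, f₀ x ∂μ)
      + ((-(∫ x, f₁ x ∂μ) + (∫ x, f₂ x ∂μ) + ∫ x, f₃ x ∂μ) + -∫ x, f₄ x ∂μ) := by
  have h : Integrable (fun x => -f₁ x + f₂ x + f₃ x) μ := (h₁.neg.add h₂).add h₃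
  rw [integral_add (f := fun x => c * f₀ x) (g := fun x => (-f₁ x + f₂ x + f₃ x) + -f₄ x)
    (h₀.const_mul c) (h.add h₄.neg), integral_add (g := fun x => -f₄ x) h h₄.neg,
    integral_neg_add_add h₁ h₂ h₃, integral_const_mul, integral_neg]

section Solution

variable {n : ℕ} {α p lam₁ lam₂ T : ℝ} {F : ℝ → Rn n → ℝ → ℝ} {ψ₁ ψ₂ ψ₃ : ℝ → Rn n → ℝ}
  {g : ℝ → H n} {κ κ' : Rn n → ℝ} {σ₁ : ℝ → Lp Ell2 2 (volume : Measure (Rn n))}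
  {σ₂ : ℕ → ℝ → Rn n → ℝ → ℝ} {a b c : ℕ → ℝ} {S₁ : ℝ × Rn n → Ell2} {G U : ℝ × Rn n → ℝ}
  {u₀ : H n} {v : Control T} {u : ℝ → H n} {L : ℝ} {η : Rn n → ℝ}

theorem IsSolution.lintegral_sq_lt_top (h : IsSolution α p T F g κ σ₁ σ₂ u₀ v u) :
    ∫⁻ s in Ioc 0 T, ∫⁻ x, ‖u s x‖ₑ ^ 2 < ∞ := by
  refine lt_of_le_of_lt ?_ h.mem_L2V
  refine (lintegral_mono fun s => ?_).trans (lintegral_mono_set Ioc_subset_Icc_self)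
  rw [sobolevNormSq_eq]
  exact le_self_add

theorem IsSolution.lintegral_gag_lt_top (hα₀ : 0 < α) (hα₁ : α < 1)
    (h : IsSolution α p T F g κ σ₁ σ₂ u₀ v u) :
    ∫⁻ s in Ioc 0 T, ∫⁻ z, ‖gag α (u s) z‖ₑ ^ 2 < ∞ := by
  have hc : 0 < ENNReal.ofReal (fracConst n α / 2) :=
    ENNReal.ofReal_pos.2 (half_pos (fracConst_pos hα₀ hα₁))
  have h1 : ∫⁻ s in Ioc 0 T, ENNReal.ofReal (fracConst n α / 2) * ∫⁻ z, ‖gag α (u s) z‖ₑ ^ 2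
      < ∞ := by
    refine lt_of_le_of_lt ?_ h.mem_L2V
    refine (lintegral_mono fun s => ?_).trans (lintegral_mono_set Ioc_subset_Icc_self)
    rw [sobolevNormSq_eq]
    exact le_add_self
  rw [lintegral_const_mul' _ _ ENNReal.ofReal_ne_top] at h1
  by_contra h2
  rw [not_lt, top_le_iff] at h2
  rw [h2, ENNReal.mul_top hc.ne'] at h1
  exact lt_irrefl _ h1

theorem IsSolution.ae_memLp_gag (hα₀ : 0 < α) (hα₁ : α < 1)
    (h : IsSolution α p T F g κ σ₁ σ₂ u₀ v u) :
    ∀ᵐ s ∂volume.restrict (Ioc 0 T), MemLp (gag α (u s)) 2 volume := by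
  have h1 := ae_lt_top' h.meas_V h.mem_L2V.ne
  filter_upwards [ae_restrict_of_ae_restrict_of_subset Ioc_subset_Icc_self h1] with s hs
  exact (memSobolev_iff hα₀ hα₁ (u s)).1 hs

theorem IsSolution.ae_memLp (hp : 0 < p) (h : IsSolution α p T F g κ σ₁ σ₂ u₀ v u) :
    ∀ᵐ s ∂volume.restrict (Ioc 0 T), MemLp (u s) (ENNReal.ofReal p) volume := by
  have h1 := ae_lt_top' (h.meas_Lp.pow_const p) h.mem_LpLp.ne
  filter_upwards [ae_restrict_of_ae_restrict_of_subset Ioc_subset_Icc_self h1] with s hs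
  exact ⟨Lp.aestronglyMeasurable _, (ENNReal.rpow_lt_top_iff_of_pos hp).1 hs⟩

theorem IsSolution.lintegral_memLp_lt_top (h : IsSolution α p T F g κ σ₁ σ₂ u₀ v u) :
    ∫⁻ s in Ioc 0 T, eLpNorm (u s) (ENNReal.ofReal p) volume ^ p < ∞ :=
  (lintegral_mono_set Ioc_subset_Icc_self).trans_lt h.mem_LpLp

theorem Control.lintegral_sq_lt_top (v : Control T) : ∫⁻ s in Ioc 0 T, ‖v s‖ₑ ^ 2 < ∞ := by
  have h := lintegral_enorm_sq_eq (μ := volume.restrict (Ioc 0 T)) v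
  simp only [ENNReal.toReal_ofNat, ENNReal.rpow_ofNat] at h
  rw [h]
  exact ENNReal.pow_lt_top (Lp.eLpNorm_lt_top v)

theorem Control.integrable_sq (v : Control T) : IntegrableOn (fun s => ‖v s‖ ^ 2) (Ioc 0 T) :=
  (Lp.memLp v).integrable_norm_pow (by norm_num)

theorem Control.integral_sq (v : Control T) : ∫ s in Ioc 0 T, ‖v s‖ ^ 2 = ‖v‖ ^ 2 := by
  rw [← real_inner_self_eq_norm_sq, L2.inner_def]
  simp only [real_inner_self_eq_norm_sq]

/-- The part of the right-hand side of the equation that is square integrable. -/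
noncomputable def rhsSquare (T : ℝ) (F : ℝ → Rn n → ℝ → ℝ) (κ : Rn n → ℝ) (S₁ : ℝ × Rn n → Ell2)
    (σ₂ : ℕ → ℝ → Rn n → ℝ → ℝ) (v : ℝ → Ell2) (G U : ℝ × Rn n → ℝ) (z : ℝ × Rn n) : ℝ :=
  -({z | |U z| ≤ 1}.indicator (fun z : ℝ × Rn n => F z.1 z.2 (U z)) z) + G z
    + noiseFun T κ S₁ σ₂ v U z

/-- The part of the right-hand side of the equation in the dual of `L^p`. -/
noncomputable def rhsDual (F : ℝ → Rn n → ℝ → ℝ) (U : ℝ × Rn n → ℝ) (z : ℝ × Rn n) : ℝ :=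
  -({z | |U z| ≤ 1}ᶜ.indicator (fun z : ℝ × Rn n => F z.1 z.2 (U z)) z)

theorem rhsSquare_add_rhsDual (v : ℝ → Ell2) (z : ℝ × Rn n) :
    rhsSquare T F κ S₁ σ₂ v G U z + rhsDual F U z
      = -F z.1 z.2 (U z) + G z + noiseFun T κ S₁ σ₂ v U z := by
  have := congrFun (indicator_self_add_compl {z | |U z| ≤ 1}
    (fun z : ℝ × Rn n => F z.1 z.2 (U z))) z
  simp only [Pi.add_apply] at this
  rw [rhsSquare, rhsDual, ← this]
  ring

/-- Brings the weak form to the shape required by `weighted_energy_identity`. The integrability of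
almost every slice has to be established first, because the Bochner integral is additive only for
integrable summands. -/
theorem IsSolution.weak_spaceTime (hα₀ : 0 < α) (hα₁ : α < 1)
    (hF : DriftCondition p lam₁ lam₂ F ψ₁ ψ₂ ψ₃)
    (hσ : DiffusionCondition κ σ₁ σ₂ a b c)
    (hκm : Measurable κ') (hκ : κ' =ᵐ[volume] κ) (hS : StronglyMeasurable S₁)
    (hS₁ : ∀ t, (fun x => S₁ (t, x)) =ᵐ[volume] σ₁ t)
    (hG : Represents T g G) (hG2 : MemLp G 2 volume)
    (h : IsSolution α p T F g κ σ₁ σ₂ u₀ v u) (hU : Represents T u U)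
    (ξ : H n) (hξ : MemLp (gag α ξ) 2 volume) (hξp : MemLp ξ (ENNReal.ofReal p) volume)
    {t : ℝ} (ht : t ∈ Icc 0 T) :
    inner ℝ (u t) ξ - inner ℝ (u 0) ξ = ∫ s in (0 : ℝ)..t,
        (-(fracConst n α / 2) * (∫ z, gag α (fun x => U (s, x)) z * gag α ξ z)
          + ∫ x, rhsSquare T F κ' S₁ σ₂ v G U (s, x) * ξ x)
          + ∫ x, rhsDual F U (s, x) * ξ x := by
  have hp := hF.two_lt
  have hpq : ENNReal.HolderConjugate (ENNReal.ofReal (p / (p - 1))) (ENNReal.ofReal p) :=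
    ((Real.HolderConjugate.conjExponent (by linarith : 1 < p)).symm).ennrealOfReal
  have hUg := hU.memLp_gag (h.lintegral_gag_lt_top hα₀ hα₁)
  have hU2 := hU.memLp_two h.lintegral_sq_lt_top
  have hUp := hU.memLp (by linarith) h.lintegral_memLp_lt_top
  have m1 := hF.memLp_small hU.measurable hU.zero hU2
  have m2 := hF.memLp_large hU.measurable hU.zero hUp
  have m3 := memLp_noiseFun hσ hκm hκ hS hS₁ (Lp.stronglyMeasurable v)
    (Control.lintegral_sq_lt_top v) hU h.continuousOn
  have i0 := integrableOn_pairing_const hUg hξ T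
  have i1 := integrableOn_pairing_const m1 (Lp.memLp ξ) T
  have i2 := integrableOn_pairing_const m2 hξp T
  have i3 := integrableOn_pairing_const m3 (Lp.memLp ξ) T
  have i4 := integrableOn_pairing_const hG2 (Lp.memLp ξ) T
  have slices : ∀ {q r : ℝ≥0∞} [ENNReal.HolderConjugate q r] {f : ℝ × Rn n → ℝ},
      MemLp f q volume → MemLp ξ r volume →
      ∀ᵐ s ∂volume.restrict (Ioc 0 T), Integrable fun x => f (s, x) * ξ x := by
    intro q r _ f hf hr
    have h1 : MemLp f q ((volume.restrict (Ioc 0 T)).prod volume) :=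
      hf.mono_measure (Measure.prod_mono Measure.restrict_le_self le_rfl)
    exact (h1.integrable_mul (hr.comp_snd (volume.restrict (Ioc (0 : ℝ) T)))).prod_right_ae
  have s1 := slices m1 (Lp.memLp ξ)
  have s2 := slices m2 hξp
  have s3 := slices m3 (Lp.memLp ξ)
  have s4 := slices hG2 (Lp.memLp ξ)
  have sub : Ioc 0 t ⊆ Ioc 0 T := Ioc_subset_Ioc_right ht.2
  have ae : ∀ {P : ℝ → Prop}, (∀ᵐ s ∂volume.restrict (Ioc 0 T), P s) →
      ∀ᵐ s ∂volume.restrict (Ioc 0 t), P s := fun hP =>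
    ae_restrict_of_ae_restrict_of_subset sub hP
  have hw := h.weak t ht ξ ((memSobolev_iff hα₀ hα₁ ξ).2 hξ) hξp
  simp only [intervalIntegral.integral_of_le ht.1] at hw ⊢
  have e0 : ∫ s in Ioc 0 t, fracForm α (u s) ξ
      = ∫ s in Ioc 0 t, fracConst n α / 2 * ∫ z, gag α (fun x => U (s, x)) z * gag α ξ z := by
    refine integral_congr_ae ?_
    filter_upwards [ae hU.ae_eq] with s hs
    rw [fracForm_eq]
    congr 1
    refine integral_congr_ae ?_
    filter_upwards [gag_congr_ae α hs] with z hz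
    rw [hz]
  have e1 : ∫ s in Ioc 0 t, ∫ x, F s x (u s x) * ξ x
      = ∫ s in Ioc 0 t, ((∫ x, {z | |U z| ≤ 1}.indicator
          (fun z : ℝ × Rn n => F z.1 z.2 (U z)) (s, x) * ξ x)
        + ∫ x, {z | |U z| ≤ 1}ᶜ.indicator
          (fun z : ℝ × Rn n => F z.1 z.2 (U z)) (s, x) * ξ x) := by
    refine integral_congr_ae ?_
    filter_upwards [ae hU.ae_eq, ae s1, ae s2] with s hs a1 a2
    rw [← integral_add a1 a2]
    refine integral_congr_ae ?_
    filter_upwards [hs] with x hx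
    have := congrFun (indicator_self_add_compl {z | |U z| ≤ 1}
      (fun z : ℝ × Rn n => F z.1 z.2 (U z))) (s, x)
    simp only [Pi.add_apply] at this
    rw [← add_mul, this, hx]
  have e2 : ∫ s in Ioc 0 t, inner ℝ (g s) ξ = ∫ s in Ioc 0 t, ∫ x, G (s, x) * ξ x := by
    refine integral_congr_ae ?_
    filter_upwards [ae hG.ae_eq] with s hs
    rw [inner_eq_integral_mul]
    refine integral_congr_ae ?_
    filter_upwards [hs] with x hx
    rw [hx]
  have e3 : ∫ s in Ioc 0 t, ∫ x, sigmaOp κ σ₁ σ₂ s (u s) (v s) x * ξ x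
      = ∫ s in Ioc 0 t, ∫ x, noiseFun T κ' S₁ σ₂ v U (s, x) * ξ x := by
    refine integral_congr_ae ?_
    filter_upwards [ae hU.ae_eq, ae (ae_restrict_mem measurableSet_Ioc)] with s hs hsT
    refine integral_congr_ae ?_
    filter_upwards [noiseFun_ae_eq (σ₂ := σ₂) (v := v) hκ hS₁ hsT hs] with x hx
    rw [hx]
  rw [e0, e1, e2, e3, integral_const_mul,
    integral_add (i1.mono_set sub) (i2.mono_set sub)] at hw
  have e4 : ∫ s in Ioc 0 t,
        ((-(fracConst n α / 2) * (∫ z, gag α (fun x => U (s, x)) z * gag α ξ z)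
          + ∫ x, rhsSquare T F κ' S₁ σ₂ v G U (s, x) * ξ x)
          + ∫ x, rhsDual F U (s, x) * ξ x)
      = ∫ s in Ioc 0 t,
        (-(fracConst n α / 2) * (∫ z, gag α (fun x => U (s, x)) z * gag α ξ z)
          + ((-(∫ x, {z | |U z| ≤ 1}.indicator
          (fun z : ℝ × Rn n => F z.1 z.2 (U z)) (s, x) * ξ x) + (∫ x, G (s, x) * ξ x)
          + ∫ x, noiseFun T κ' S₁ σ₂ v U (s, x) * ξ x) + -∫ x, {z | |U z| ≤ 1}ᶜ.indicator
          (fun z : ℝ × Rn n => F z.1 z.2 (U z)) (s, x) * ξ x)) := by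
    refine integral_congr_ae ?_
    filter_upwards [ae s1, ae s2, ae s3, ae s4] with s a1 a2 a3 a4
    have f1 : ∫ x, rhsSquare T F κ' S₁ σ₂ v G U (s, x) * ξ x
        = -(∫ x, {z | |U z| ≤ 1}.indicator
          (fun z : ℝ × Rn n => F z.1 z.2 (U z)) (s, x) * ξ x) + (∫ x, G (s, x) * ξ x)
          + ∫ x, noiseFun T κ' S₁ σ₂ v U (s, x) * ξ x := by
      rw [← integral_neg_add_add a1 a4 a3]
      congr 1
      ext x
      simp only [rhsSquare]
      ring
    have f2 : ∫ x, rhsDual F U (s, x) * ξ x = -∫ x, {z | |U z| ≤ 1}ᶜ.indicator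
          (fun z : ℝ × Rn n => F z.1 z.2 (U z)) (s, x) * ξ x := by
      rw [← integral_neg]
      congr 1
      ext x
      simp only [rhsDual]
      ring
    rw [f1, f2]
    ring
  have j0 := i0.mono_set sub
  have j1 := i1.mono_set sub
  have j2 := i2.mono_set sub
  have j3 := i3.mono_set sub
  have j4 := i4.mono_set sub
  have e5 := e4.trans (integral_mul_add_neg_add_add _ j0 j1 j4 j3 j2)
  rw [e5, h.initial]
  linarith

end Solution

/-! ### The weighted energy inequality. -/

section Solution

variable {n : ℕ} {α p lam₁ lam₂ T : ℝ} {F : ℝ → Rn n → ℝ → ℝ} {ψ₁ ψ₂ ψ₃ : ℝ → Rn n → ℝ}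
  {g : ℝ → H n} {κ κ' : Rn n → ℝ} {σ₁ : ℝ → Lp Ell2 2 (volume : Measure (Rn n))}
  {σ₂ : ℕ → ℝ → Rn n → ℝ → ℝ} {a b c : ℕ → ℝ} {S₁ : ℝ × Rn n → Ell2} {G U : ℝ × Rn n → ℝ}
  {u₀ : H n} {v : Control T} {u : ℝ → H n} {L B Γ : ℝ} {η : Rn n → ℝ}

/-- The source density controlling the growth of the weighted energy. -/
noncomputable def source (ψ₁ : ℝ → Rn n → ℝ) (G : ℝ × Rn n → ℝ) (S₁ : ℝ × Rn n → Ell2) (B : ℝ)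
    (κ : Rn n → ℝ) (z : ℝ × Rn n) : ℝ :=
  2 * |ψ₁ z.1 z.2| + G z ^ 2 + 2 * ‖S₁ z‖ ^ 2 + 2 * (B * κ z.2) ^ 2

theorem source_nonneg (z : ℝ × Rn n) : 0 ≤ source ψ₁ G S₁ B κ z := by
  unfold source
  positivity

/-- Integrability is what makes the weighted data small at infinity, uniformly, as the density
involves neither the solution nor the control. -/
theorem integrable_source (hF : DriftCondition p lam₁ lam₂ F ψ₁ ψ₂ ψ₃)
    (hσ : DiffusionCondition κ σ₁ σ₂ a b c) (hκ : κ' =ᵐ[volume] κ) (hS : StronglyMeasurable S₁)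
    (hS₁ : ∀ t, (fun x => S₁ (t, x)) =ᵐ[volume] σ₁ t) (hG2 : MemLp G 2 volume) (B T : ℝ) :
    Integrable (source ψ₁ G S₁ B κ') ((volume.restrict (Ioc 0 T)).prod volume) := by
  have hle : (volume.restrict (Ioc 0 T)).prod (volume : Measure (Rn n)) ≤ volume :=
    Measure.prod_mono Measure.restrict_le_self le_rfl
  have h1 : Integrable (fun z : ℝ × Rn n => ψ₁ z.1 z.2)
      ((volume.restrict (Ioc 0 T)).prod volume) := by
    have := (hF.psi₁_L1 0 T).mono_set
      (prod_mono (Ioc_subset_Icc_self (a := (0 : ℝ)) (b := T)) (subset_univ univ))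
    rw [IntegrableOn, Measure.volume_eq_prod, ← Measure.prod_restrict,
      Measure.restrict_univ] at this
    exact this
  have h2 : Integrable (fun z => G z ^ 2) ((volume.restrict (Ioc 0 T)).prod volume) :=
    (hG2.mono_measure hle).integrable_sq
  have h3 : Integrable (fun z => ‖S₁ z‖ ^ 2) ((volume.restrict (Ioc 0 T)).prod volume) := by
    obtain ⟨M, hM⟩ := isCompact_Icc.exists_bound_of_continuousOn
      (hσ.sigma₁_cont.continuousOn (s := Icc 0 T))
    refine MemLp.integrable_norm_pow (p := 2) ⟨hS.aestronglyMeasurable, ?_⟩ (by norm_num)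
    rw [eLpNorm_lt_top_iff_lintegral_rpow_enorm_lt_top (by norm_num) (by norm_num),
      lintegral_prod _ (hS.enorm.pow_const _).aemeasurable]
    have key : ∀ᵐ s ∂volume.restrict (Ioc 0 T),
        ∫⁻ x, ‖S₁ (s, x)‖ₑ ^ (2 : ℝ≥0∞).toReal ≤ ENNReal.ofReal M ^ 2 := by
      filter_upwards [ae_restrict_mem measurableSet_Ioc] with s hs
      rw [lintegral_enorm_sq_eq fun x => S₁ (s, x), eLpNorm_congr_ae (hS₁ s), ← Lp.enorm_def,
        ← ofReal_norm]
      exact pow_le_pow_left' (ENNReal.ofReal_le_ofReal (hM s (Ioc_subset_Icc_self hs))) 2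
    refine (lintegral_mono_ae key).trans_lt ?_
    rw [lintegral_const]
    exact ENNReal.mul_lt_top (ENNReal.pow_lt_top ENNReal.ofReal_lt_top) (by simp)
  have h4 : Integrable (fun z : ℝ × Rn n => (B * κ' z.2) ^ 2)
      ((volume.restrict (Ioc 0 T)).prod volume) := by
    have hk : MemLp (fun x => B * κ' x) 2 volume :=
      (((memLp_congr_ae hκ).2 hσ.kappa_L2).const_mul B)
    exact (hk.comp_snd (volume.restrict (Ioc (0 : ℝ) T))).integrable_sq
  exact (((h1.abs.const_mul 2).add h2).add (h3.const_mul 2)).add (h4.const_mul 2)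

/-- Young's inequality for the noise term. -/
theorem two_mul_abs_mul_le {r e q w Γ : ℝ} (hr : 0 ≤ r)
    (he : |e| ≤ (q + Γ * r) * w) : 2 * (r * |e|) ≤ q ^ 2 + (Γ ^ 2 + 2 * w ^ 2) * r ^ 2 := by
  have h1 : r * |e| ≤ r * ((q + Γ * r) * w) := mul_le_mul_of_nonneg_left he hr
  -- The two squares give `2 r q w ≤ q² + r² w²` and `2 Γ w r² ≤ (Γ² + w²) r²`.
  nlinarith [sq_nonneg (q - r * w), sq_nonneg (r * (Γ - w))]

/-- Pointwise, coercivity gives `-2 F U ≤ 2 |ψ₁|` after dropping the `L^p` term, Young gives `2 G U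
≤ G² + U²`, and the noise contributes `(Γ² + 2‖v‖²) U²` plus source terms. The nonlocal form is kept
untouched, as it is handled differently for the weight 1 and for a tail weight. -/
theorem weighted_energy_inequality (hα₀ : 0 < α) (hα₁ : α < 1)
    (hF : DriftCondition p lam₁ lam₂ F ψ₁ ψ₂ ψ₃)
    (hσ : DiffusionCondition κ σ₁ σ₂ a b c)
    (hκm : Measurable κ') (hκ : κ' =ᵐ[volume] κ) (hS : StronglyMeasurable S₁)
    (hS₁ : ∀ t, (fun x => S₁ (t, x)) =ᵐ[volume] σ₁ t)
    (hG : Represents T g G) (hG2 : MemLp G 2 volume)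
    (hnoise : ∀ᵐ x : Rn n, ∀ (τ w : Ell2) (t s : ℝ),
      |∑' k, (τ k + κ' x * σ₂ k t x s) * w k| ≤ (‖τ‖ + B * |κ' x| + Γ * |s|) * ‖w‖)
    (h : IsSolution α p T F g κ σ₁ σ₂ u₀ v u) (hη : IsWeight L η) {t : ℝ} (ht : t ∈ Icc 0 T) :
    IntegrableOn (fun s => ∫ z, gag α (u s) z * gag α (fun x => η x * u s x) z) (Ioc 0 T) ∧
    (∫ x, η x * u t x ^ 2)
        + fracConst n α * ∫ s in (0 : ℝ)..t, ∫ z, gag α (u s) z * gag α (fun x => η x * u s x) z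
      ≤ (∫ x, η x * u₀ x ^ 2)
        + (∫ z, η z.2 * source ψ₁ G S₁ B κ' z ∂((volume.restrict (Ioc 0 T)).prod volume))
        + ∫ s in (0 : ℝ)..t, (1 + Γ ^ 2 + 2 * ‖v s‖ ^ 2) * ∫ x, η x * u s x ^ 2 := by
  have hp := hF.two_lt
  have hpq : ENNReal.HolderConjugate (ENNReal.ofReal (p / (p - 1))) (ENNReal.ofReal p) :=
    ((Real.HolderConjugate.conjExponent (by linarith : 1 < p)).symm).ennrealOfReal
  obtain ⟨U, hU⟩ := exists_represents (u := u) (T := T)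
    ((h.continuousOn.mono Ioc_subset_Icc_self).aestronglyMeasurable measurableSet_Ioc)
  have hUg := hU.memLp_gag (h.lintegral_gag_lt_top hα₀ hα₁)
  have hUg' := hU.memLp_gag_mul hα₀ hα₁ hη (h.lintegral_gag_lt_top hα₀ hα₁) h.lintegral_sq_lt_top
  have hU2 := hU.memLp_two h.lintegral_sq_lt_top
  have hUp := hU.memLp (by linarith) h.lintegral_memLp_lt_top
  have m1 := hF.memLp_small hU.measurable hU.zero hU2
  have m2 := hF.memLp_large hU.measurable hU.zero hUp
  have m3 := memLp_noiseFun hσ hκm hκ hS hS₁ (Lp.stronglyMeasurable v)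
    (Control.lintegral_sq_lt_top v) hU h.continuousOn
  have hΦ₂ : MemLp (rhsSquare T F κ' S₁ σ₂ v G U) 2 volume := (m1.neg.add hG2).add m3
  have hΦq : MemLp (rhsDual F U) (ENNReal.ofReal (p / (p - 1))) volume := m2.neg
  obtain ⟨hJ, hid⟩ := weighted_energy_identity hα₀ hα₁ hη ENNReal.ofReal_ne_top hU2 hUp hUg hUg'
    hΦ₂ hΦq h.continuousOn hU.ae_eq (h.ae_memLp_gag hα₀ hα₁) (h.ae_memLp (by linarith))
    (fracConst n α / 2)
    (fun ξ hξ hξp t ht => h.weak_spaceTime hα₀ hα₁ hF hσ hκm hκ hS hS₁ hG hG2 hU ξ hξ hξp ht) ht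
  have hFr : IntegrableOn (fun s => ∫ z, gag α (fun x => U (s, x)) z
      * gag α (fun x => η x * U (s, x)) z) (Ioc 0 T) :=
    Integrable.integrableOn (Integrable.integral_prod_left (hUg.integrable_mul hUg'))
  have hFreq : ∀ᵐ s ∂volume.restrict (Ioc 0 T), ∫ z, gag α (fun x => U (s, x)) z
      * gag α (fun x => η x * U (s, x)) z
      = ∫ z, gag α (u s) z * gag α (fun x => η x * u s x) z := by
    filter_upwards [hU.ae_eq] with s hs
    have hs' : (fun x => η x * U (s, x)) =ᵐ[volume] fun x => η x * u s x := by
      filter_upwards [hs] with x hx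
      rw [hx]
    refine integral_congr_ae ?_
    filter_upwards [gag_congr_ae α hs, gag_congr_ae α hs'] with z h1 h2
    rw [h1, h2]
  have hFru : IntegrableOn (fun s => ∫ z, gag α (u s) z * gag α (fun x => η x * u s x) z)
      (Ioc 0 T) := Integrable.congr hFr hFreq
  refine ⟨hFru, ?_⟩
  have hQ := integrable_source (κ' := κ') hF hσ hκ hS hS₁ hG2 B T
  have hηQ : Integrable (fun z : ℝ × Rn n => η z.2 * source ψ₁ G S₁ B κ' z)
      ((volume.restrict (Ioc 0 T)).prod volume) :=
    memLp_one_iff_integrable.1 (hη.memLp_mul measurable_snd (memLp_one_iff_integrable.2 hQ))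
  have hw2 : MemLp (fun z : ℝ × Rn n => η z.2 * U z) 2 volume := hη.memLp_mul measurable_snd hU2
  have hwp : MemLp (fun z : ℝ × Rn n => η z.2 * U z) (ENNReal.ofReal p) volume :=
    hη.memLp_mul measurable_snd hUp
  have sl2 : ∀ᵐ s ∂volume.restrict (Ioc 0 T), Integrable fun x =>
      rhsSquare T F κ' S₁ σ₂ v G U (s, x) * (η x * U (s, x)) :=
    ae_restrict_of_ae (Integrable.prod_right_ae (hΦ₂.integrable_mul hw2))
  have slq : ∀ᵐ s ∂volume.restrict (Ioc 0 T), Integrable fun x =>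
      rhsDual F U (s, x) * (η x * U (s, x)) :=
    ae_restrict_of_ae (Integrable.prod_right_ae (hΦq.integrable_mul hwp))
  have hpt : ∀ᵐ s ∂volume.restrict (Ioc 0 T),
      2 * ((-(fracConst n α / 2) * (∫ z, gag α (fun x => U (s, x)) z
            * gag α (fun x => η x * U (s, x)) z)
          + ∫ x, rhsSquare T F κ' S₁ σ₂ v G U (s, x) * (η x * U (s, x)))
          + ∫ x, rhsDual F U (s, x) * (η x * U (s, x)))
      ≤ -fracConst n α * (∫ z, gag α (u s) z * gag α (fun x => η x * u s x) z)
        + ((∫ x, η x * source ψ₁ G S₁ B κ' (s, x))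
          + (1 + Γ ^ 2 + 2 * ‖v s‖ ^ 2) * ∫ x, η x * u s x ^ 2) := by
    filter_upwards [hU.ae_eq, hFreq, sl2, slq, hηQ.prod_right_ae,
      ae_restrict_mem measurableSet_Ioc] with s hs hfr a2 aq aQ hsT
    rw [hfr]
    have hsq : Integrable fun x => η x * u s x ^ 2 :=
      memLp_one_iff_integrable.1 (hη.memLp_mul measurable_id
        (memLp_one_iff_integrable.2 (Lp.memLp (u s)).integrable_sq))
    have hmain : ∫ x, 2 * (rhsSquare T F κ' S₁ σ₂ v G U (s, x) * (η x * U (s, x))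
          + rhsDual F U (s, x) * (η x * U (s, x)))
        ≤ ∫ x, (η x * source ψ₁ G S₁ B κ' (s, x)
          + (1 + Γ ^ 2 + 2 * ‖v s‖ ^ 2) * (η x * u s x ^ 2)) := by
      refine integral_mono_ae ((a2.add aq).const_mul 2) (aQ.add (hsq.const_mul _)) ?_
      filter_upwards [hs, hnoise] with x hx hN
      have hc := hF.coercive s x (U (s, x))
      have hl : 0 ≤ lam₁ * |U (s, x)| ^ p := mul_nonneg hF.lam₁_pos.le (by positivity)
      have hb := hN (S₁ (s, x)) (v s) s (U (s, x))
      have hnf : noiseFun T κ' S₁ σ₂ v U (s, x)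
          = ∑' k, (S₁ (s, x) k + κ' x * σ₂ k s x (U (s, x))) * v s k := by
        rw [noiseFun, indicator_of_mem (show (s, x) ∈ Ioc 0 T ×ˢ univ from ⟨hsT, mem_univ _⟩)]
      rw [← hnf] at hb
      have hy := two_mul_abs_mul_le (abs_nonneg (U (s, x))) hb
      rw [sq_abs] at hy
      have hq2 : (‖S₁ (s, x)‖ + B * |κ' x|) ^ 2 ≤ 2 * ‖S₁ (s, x)‖ ^ 2 + 2 * (B * κ' x) ^ 2 := by
        have : (B * κ' x) ^ 2 = (B * |κ' x|) ^ 2 := by rw [mul_pow, mul_pow, sq_abs]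
        rw [this]
        nlinarith [sq_nonneg (‖S₁ (s, x)‖ - B * |κ' x|)]
      have hun : U (s, x) * noiseFun T κ' S₁ σ₂ v U (s, x)
          ≤ |U (s, x)| * |noiseFun T κ' S₁ σ₂ v U (s, x)| := by
        rw [← abs_mul]
        exact le_abs_self _
      have hψ := le_abs_self (ψ₁ s x)
      have hadd := rhsSquare_add_rhsDual (T := T) (F := F) (κ := κ') (S₁ := S₁) (σ₂ := σ₂)
        (G := G) (U := U) v (s, x)
      have hbr : 2 * ((-F s x (U (s, x)) + G (s, x) + noiseFun T κ' S₁ σ₂ v U (s, x)) * U (s, x))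
          ≤ source ψ₁ G S₁ B κ' (s, x) + (1 + Γ ^ 2 + 2 * ‖v s‖ ^ 2) * U (s, x) ^ 2 := by
        simp only [source]
        nlinarith [sq_nonneg (U (s, x) - G (s, x))]
      have := mul_le_mul_of_nonneg_left hbr (hη.nonneg x)
      calc 2 * (rhsSquare T F κ' S₁ σ₂ v G U (s, x) * (η x * U (s, x))
          + rhsDual F U (s, x) * (η x * U (s, x)))
          = η x * (2 * ((rhsSquare T F κ' S₁ σ₂ v G U (s, x) + rhsDual F U (s, x))
            * U (s, x))) := by ring
        _ ≤ η x * (source ψ₁ G S₁ B κ' (s, x)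
            + (1 + Γ ^ 2 + 2 * ‖v s‖ ^ 2) * U (s, x) ^ 2) := by rw [hadd]; exact this
        _ = _ := by rw [← hx]; ring
    rw [integral_const_mul, integral_add a2 aq, integral_add aQ (hsq.const_mul _),
      integral_const_mul] at hmain
    linarith
  have sub : Ioc 0 t ⊆ Ioc 0 T := Ioc_subset_Ioc_right ht.2
  have hE : ContinuousOn (fun s => ∫ x, η x * u s x ^ 2) (Icc 0 T) :=
    continuousOn_weighted_energy hη h.continuousOn
  have hA : IntegrableOn (fun s => 1 + Γ ^ 2 + 2 * ‖v s‖ ^ 2) (Ioc 0 T) :=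
    (integrable_const _).add ((Control.integrable_sq v).const_mul 2)
  have hAE : IntegrableOn (fun s => (1 + Γ ^ 2 + 2 * ‖v s‖ ^ 2) * ∫ x, η x * u s x ^ 2)
      (Ioc 0 T) := by
    have hT : 0 ≤ T := ht.1.trans ht.2
    have h1 := ((intervalIntegrable_iff_integrableOn_Ioc_of_le hT).2 hA).mul_continuousOn
      (by rwa [uIcc_of_le hT])
    exact (intervalIntegrable_iff_integrableOn_Ioc_of_le hT).1 h1
  have hq : IntegrableOn (fun s => ∫ x, η x * source ψ₁ G S₁ B κ' (s, x)) (Ioc 0 T) :=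
    hηQ.integral_prod_left
  have hqle : ∫ s in Ioc 0 t, ∫ x, η x * source ψ₁ G S₁ B κ' (s, x)
      ≤ ∫ z, η z.2 * source ψ₁ G S₁ B κ' z ∂((volume.restrict (Ioc 0 T)).prod volume) := by
    rw [integral_prod _ hηQ]
    exact setIntegral_mono_set hq (ae_of_all _ fun s =>
      integral_nonneg fun x => mul_nonneg (hη.nonneg x) (source_nonneg _)) sub.eventuallyLE
  rw [h.initial] at hid
  simp only [intervalIntegral.integral_of_le ht.1] at hid ⊢
  rw [← integral_const_mul] at hid
  have hmono := integral_mono_ae ((hJ.mono_set sub).const_mul 2)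
    (((hFru.mono_set sub).const_mul (-fracConst n α)).add
      ((hq.mono_set sub).add (hAE.mono_set sub)))
    (ae_restrict_of_ae_restrict_of_subset sub hpt)
  rw [← hid] at hmono
  have e1 := integral_add ((hFru.mono_set sub).const_mul (-fracConst n α))
    ((hq.mono_set sub).add (hAE.mono_set sub))
  have e2 := integral_add (hq.mono_set sub) (hAE.mono_set sub)
  rw [integral_const_mul] at e1
  simp only [Pi.add_apply] at e1 hmono
  linarith

end Solution

/-! ### Tail weights and Grönwall's inequality for bounded controls. -/

theorem isWeight_one (n : ℕ) : IsWeight 0 (fun _ : Rn n => (1 : ℝ)) :=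
  ⟨measurable_const, fun _ => zero_le_one, fun _ => le_rfl, fun x y => by simp, le_rfl, zero_le_one⟩

/-- The weight `min(1, |x|/(m+1))`. -/
noncomputable def tailWeight (n m : ℕ) (x : Rn n) : ℝ := min 1 (1 / ((m : ℝ) + 1) * ‖x‖)

theorem isWeight_tailWeight (n m : ℕ) : IsWeight (1 / ((m : ℝ) + 1)) (tailWeight n m) where
  measurable := by unfold tailWeight; fun_prop
  nonneg x := by unfold tailWeight; positivity
  le_one x := min_le_left _ _
  lip x y := by
    unfold tailWeight
    refine (abs_min_sub_min_le_max _ _ _ _).trans (max_le (by simp; positivity) ?_)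
    rw [← mul_sub, abs_mul, abs_of_nonneg (by positivity)]
    exact mul_le_mul_of_nonneg_left (abs_norm_sub_norm_le x y) (by positivity)
  L_nonneg := by positivity
  L_le_one := by
    rw [div_le_one (by positivity)]
    linarith [(Nat.cast_nonneg m : (0 : ℝ) ≤ m)]

theorem tendsto_tailWeight {n : ℕ} (x : Rn n) :
    Tendsto (fun m => tailWeight n m x) atTop (𝓝 0) := by
  have h := (tendsto_const_nhds (x := (1 : ℝ))).min
    ((tendsto_one_div_add_atTop_nhds_zero_nat (𝕜 := ℝ)).mul_const ‖x‖)
  simpa [tailWeight] using h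

theorem tailWeight_eq_one {n m : ℕ} {x : Rn n} (hx : (m : ℝ) + 1 ≤ ‖x‖) : tailWeight n m x = 1 := by
  refine min_eq_left ?_
  rw [one_div, inv_mul_eq_div, one_le_div (by positivity)]
  exact hx

theorem tendsto_integral_tailWeight {n : ℕ} {Z : Type*} [MeasurableSpace Z] {μ : Measure Z}
    {φ : Z → Rn n} (hφ : Measurable φ) {f : Z → ℝ} (hf : Integrable f μ) :
    Tendsto (fun m => ∫ z, tailWeight n m (φ z) * f z ∂μ) atTop (𝓝 0) := by
  have h := tendsto_integral_of_dominated_convergence (μ := μ)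
    (F := fun m z => tailWeight n m (φ z) * f z) (f := fun _ => 0) (fun z => ‖f z‖)
    (fun m => ((isWeight_tailWeight n m).measurable.comp hφ).aestronglyMeasurable.mul hf.1)
    hf.norm
    (fun m => ae_of_all _ fun z => by
      rw [norm_mul, Real.norm_of_nonneg ((isWeight_tailWeight n m).nonneg _)]
      exact mul_le_of_le_one_left (norm_nonneg _) ((isWeight_tailWeight n m).le_one _))
    (ae_of_all _ fun z => by simpa using (tendsto_tailWeight (φ z)).mul_const (f z))
  simpa using h

/-- The integral of the coefficient is at most `(1 + Γ²) T + 2 R²`: the control enters only through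
its norm, which is the source of uniformity. -/
theorem gronwall_control {T R Γ D : ℝ} {v : Control T} (hv : ‖v‖ ≤ R) {E : ℝ → ℝ}
    (hE : ContinuousOn E (Icc 0 T)) (hD : 0 ≤ D)
    (h : ∀ t ∈ Icc 0 T, E t ≤ D + ∫ s in (0 : ℝ)..t, (1 + Γ ^ 2 + 2 * ‖v s‖ ^ 2) * E s)
    {t : ℝ} (ht : t ∈ Icc 0 T) : E t ≤ D * Real.exp ((1 + Γ ^ 2) * T + 2 * R ^ 2) := by
  have sub : Icc 0 t ⊆ Icc 0 T := Icc_subset_Icc_right ht.2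
  have hA : IntegrableOn (fun s => 1 + Γ ^ 2 + 2 * ‖v s‖ ^ 2) (Ioc 0 T) :=
    (integrable_const _).add ((Control.integrable_sq v).const_mul 2)
  have hA' := hA.mono_set (Ioc_subset_Ioc_right ht.2)
  refine (gronwall_integral ht.1 (hE.mono sub)
    ((intervalIntegrable_iff_integrableOn_Ioc_of_le ht.1).2 hA') (fun s => by positivity)
    fun s hs => h s (sub hs)).trans (mul_le_mul_of_nonneg_left (Real.exp_le_exp.2 ?_) hD)
  rw [intervalIntegral.integral_of_le ht.1]
  calc ∫ s in Ioc 0 t, (1 + Γ ^ 2 + 2 * ‖v s‖ ^ 2)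
      ≤ ∫ s in Ioc 0 T, (1 + Γ ^ 2 + 2 * ‖v s‖ ^ 2) :=
        setIntegral_mono_set hA (ae_of_all _ fun s => by positivity)
          (Ioc_subset_Ioc_right ht.2).eventuallyLE
    _ = (1 + Γ ^ 2) * T + 2 * ‖v‖ ^ 2 := by
        rw [integral_add (integrable_const _) ((Control.integrable_sq v).const_mul 2),
          integral_const_mul, Control.integral_sq]
        simp [ht.1.trans ht.2, mul_comm]
    _ ≤ _ := by
        have := pow_le_pow_left₀ (norm_nonneg v) hv 2
        linarith

/-! ### The weighted bound, uniform over a ball of controls. -/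

section Solution

variable {n : ℕ} {α p lam₁ lam₂ T : ℝ} {F : ℝ → Rn n → ℝ → ℝ} {ψ₁ ψ₂ ψ₃ : ℝ → Rn n → ℝ}
  {g : ℝ → H n} {κ κ' : Rn n → ℝ} {σ₁ : ℝ → Lp Ell2 2 (volume : Measure (Rn n))}
  {σ₂ : ℕ → ℝ → Rn n → ℝ → ℝ} {a b c : ℕ → ℝ} {S₁ : ℝ × Rn n → Ell2} {G U : ℝ × Rn n → ℝ}
  {B Γ : ℝ}

/-- The weighted energy is controlled by the weighted data, up to an error that is small together
with the commutator mass of the weight, uniformly over controls in a ball. -/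
theorem exists_uniform_weighted_bound (hα₀ : 0 < α) (hα₁ : α < 1)
    (hF : DriftCondition p lam₁ lam₂ F ψ₁ ψ₂ ψ₃)
    (hσ : DiffusionCondition κ σ₁ σ₂ a b c)
    (hκm : Measurable κ') (hκ : κ' =ᵐ[volume] κ) (hS : StronglyMeasurable S₁)
    (hS₁ : ∀ t, (fun x => S₁ (t, x)) =ᵐ[volume] σ₁ t)
    (hG : Represents T g G) (hG2 : MemLp G 2 volume)
    (hnoise : ∀ᵐ x : Rn n, ∀ (τ w : Ell2) (t s : ℝ),
      |∑' k, (τ k + κ' x * σ₂ k t x s) * w k| ≤ (‖τ‖ + B * |κ' x| + Γ * |s|) * ‖w‖)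
    (hT : 0 ≤ T) (u₀ : H n) (R : ℝ) :
    ∃ X : ℝ, ∀ v : Control T, ‖v‖ ≤ R → ∀ u : ℝ → H n,
      IsSolution α p T F g κ σ₁ σ₂ u₀ v u → ∀ (L μ : ℝ) (η : Rn n → ℝ), IsWeight L η → 0 < μ →
      kernelMass n α L ≤ ENNReal.ofReal (μ ^ 2) → ∀ t ∈ Icc 0 T,
      ∫ x, η x * u t x ^ 2 ≤ ((∫ x, η x * u₀ x ^ 2)
        + (∫ z, η z.2 * source ψ₁ G S₁ B κ' z ∂((volume.restrict (Ioc 0 T)).prod volume))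
        + μ * X) * Real.exp ((1 + Γ ^ 2) * T + 2 * R ^ 2) := by
  set M : ℝ := (1 + Γ ^ 2) * T + 2 * R ^ 2 with hM
  have hM0 : 0 ≤ M := by positivity
  have hCf := fracConst_pos (n := n) hα₀ hα₁
  have hsrc : ∀ {L : ℝ} {η : Rn n → ℝ}, IsWeight L η → 0 ≤ ∫ z, η z.2 * source ψ₁ G S₁ B κ' z
      ∂((volume.restrict (Ioc 0 T)).prod volume) := fun hη =>
    integral_nonneg fun z => mul_nonneg (hη.nonneg _) (source_nonneg z)
  have hsq : ∀ {L : ℝ} {η : Rn n → ℝ}, IsWeight L η → ∀ w : H n, 0 ≤ ∫ x, η x * w x ^ 2 :=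
    fun hη w => integral_nonneg fun z => mul_nonneg (hη.nonneg _) (sq_nonneg _)
  set D₀ : ℝ := (∫ x, (1 : ℝ) * u₀ x ^ 2) + ∫ z, (1 : ℝ) * source ψ₁ G S₁ B κ' z
    ∂((volume.restrict (Ioc 0 T)).prod volume) with hD₀
  have hD₀0 : 0 ≤ D₀ := add_nonneg (hsq (isWeight_one n) u₀) (hsrc (isWeight_one n))
  set M₁ : ℝ := D₀ * Real.exp M with hM₁
  have hM₁0 : 0 ≤ M₁ := by positivity
  -- `Y` bounds the time integral of `∬ |Du|² + ∫ u²`: the first summand comes from the unweighted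
  -- inequality at time `T`, the second from `∫ u(t)² ≤ M₁`.
  set Y : ℝ := (D₀ + M * M₁) / fracConst n α + T * M₁ with hY
  -- The nonlocal term is at least `-(μ/2) Y` and is multiplied by `fracConst n α`. The witness is
  -- fixed before `μ` and `η`, so `μ` may later be chosen in terms of it.
  refine ⟨fracConst n α * (Y / 2), fun v hv u h L μ η hη hμ hL => ?_⟩
  have hA : IntegrableOn (fun s => 1 + Γ ^ 2 + 2 * ‖v s‖ ^ 2) (Ioc 0 T) :=
    (integrable_const _).add ((Control.integrable_sq v).const_mul 2)
  have hAint : ∫ s in Ioc 0 T, (1 + Γ ^ 2 + 2 * ‖v s‖ ^ 2) ≤ M := by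
    rw [integral_add (integrable_const _) ((Control.integrable_sq v).const_mul 2),
      integral_const_mul, Control.integral_sq]
    have := pow_le_pow_left₀ (norm_nonneg v) hv 2
    simp [hT] at this ⊢
    linarith
  -- the unweighted estimate
  have hone := fun t ht => weighted_energy_inequality hα₀ hα₁ hF hσ hκm hκ hS hS₁ hG hG2 hnoise h
    (isWeight_one n) (t := t) ht
  have hgag : ∀ s, ∫ z, gag α (u s) z * gag α (fun x => 1 * u s x) z = ∫ z, gag α (u s) z ^ 2 := by
    intro s
    simp only [one_mul, pow_two]
  simp only [hgag] at hone
  have hcont := continuousOn_weighted_energy (isWeight_one n) h.continuousOn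
  have hApos : ∀ t ∈ Icc 0 T, 0 ≤ ∫ s in (0 : ℝ)..t, ∫ z, gag α (u s) z ^ 2 := fun t ht =>
    intervalIntegral.integral_nonneg ht.1 fun s _ => integral_nonneg fun z => sq_nonneg _
  have hbd : ∀ t ∈ Icc 0 T, ∫ x, (1 : ℝ) * u t x ^ 2 ≤ M₁ := fun t ht =>
    gronwall_control hv hcont hD₀0 (fun s hs => by
      have h1 := (hone s hs).2
      have h2 := mul_nonneg hCf.le (hApos s hs)
      linarith) ht
  have hTT : T ∈ Icc 0 T := right_mem_Icc.2 hT
  have hAu : ∫ s in Ioc 0 T, (1 + Γ ^ 2 + 2 * ‖v s‖ ^ 2) * ∫ x, (1 : ℝ) * u s x ^ 2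
      ≤ M * M₁ := by
    have hi : IntegrableOn (fun s => (1 + Γ ^ 2 + 2 * ‖v s‖ ^ 2) * ∫ x, (1 : ℝ) * u s x ^ 2)
        (Ioc 0 T) := by
      have h1 := ((intervalIntegrable_iff_integrableOn_Ioc_of_le hT).2 hA).mul_continuousOn
        (by rw [uIcc_of_le hT]; exact hcont)
      exact (intervalIntegrable_iff_integrableOn_Ioc_of_le hT).1 h1
    calc _ ≤ ∫ s in Ioc 0 T, (1 + Γ ^ 2 + 2 * ‖v s‖ ^ 2) * M₁ := by
          refine setIntegral_mono_on hi (hA.mul_const _) measurableSet_Ioc fun s hs => ?_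
          exact mul_le_mul_of_nonneg_left (hbd s (Ioc_subset_Icc_self hs)) (by positivity)
      _ ≤ M * M₁ := by
          rw [integral_mul_const]
          exact mul_le_mul_of_nonneg_right hAint hM₁0
  have hAi : IntegrableOn (fun s => ∫ z, gag α (u s) z ^ 2) (Ioc 0 T) := (hone T hTT).1
  have hgagint : ∫ s in Ioc 0 T, ∫ z, gag α (u s) z ^ 2 ≤ (D₀ + M * M₁) / fracConst n α := by
    rw [le_div_iff₀ hCf, mul_comm]
    have h1 := (hone T hTT).2
    have h2 := hsq (isWeight_one n) (u T)
    simp only [intervalIntegral.integral_of_le hT] at h1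
    linarith
  have hui : IntegrableOn (fun s => ∫ x, (1 : ℝ) * u s x ^ 2) (Ioc 0 T) :=
    (hcont.integrableOn_Icc).mono_set Ioc_subset_Icc_self
  have huint : ∫ s in Ioc 0 T, ∫ x, (1 : ℝ) * u s x ^ 2 ≤ T * M₁ := by
    calc _ ≤ ∫ s in Ioc 0 T, M₁ :=
          setIntegral_mono_on hui (integrable_const _) measurableSet_Ioc fun s hs =>
            hbd s (Ioc_subset_Icc_self hs)
      _ = T * M₁ := by simp [hT]
  have hYint : ∫ s in Ioc 0 T, ((∫ z, gag α (u s) z ^ 2) + ∫ x, (1 : ℝ) * u s x ^ 2) ≤ Y := by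
    rw [integral_add hAi hui]
    exact add_le_add hgagint huint
  -- the weighted estimate
  intro t ht
  refine gronwall_control hv (continuousOn_weighted_energy hη h.continuousOn) ?_ ?_ ht
  · have hY0 : 0 ≤ Y := by positivity
    have := hsq hη u₀
    have := hsrc hη
    positivity
  intro r hr
  obtain ⟨i1, i2⟩ := weighted_energy_inequality hα₀ hα₁ hF hσ hκm hκ hS hS₁ hG hG2 hnoise h hη hr
  have sub : Ioc 0 r ⊆ Ioc 0 T := Ioc_subset_Ioc_right hr.2
  have hlow : -(μ / 2 * Y)
      ≤ ∫ s in (0 : ℝ)..r, ∫ z, gag α (u s) z * gag α (fun x => η x * u s x) z := by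
    rw [intervalIntegral.integral_of_le hr.1]
    have h1 : ∫ s in Ioc 0 r,
        -(μ / 2) * ((∫ z, gag α (u s) z ^ 2) + ∫ x, (1 : ℝ) * u s x ^ 2)
        ≤ ∫ s in Ioc 0 r, ∫ z, gag α (u s) z * gag α (fun x => η x * u s x) z := by
      refine integral_mono_ae (((hAi.add hui).mono_set sub).const_mul _) (i1.mono_set sub) ?_
      filter_upwards [ae_restrict_of_ae_restrict_of_subset sub (h.ae_memLp_gag hα₀ hα₁)] with s hs
      have := hη.neg_le_integral_gag hα₀ hα₁ (Lp.memLp (u s)) hs hμ hL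
      simp only [one_mul]
      linarith
    have h2 : ∫ s in Ioc 0 r, ((∫ z, gag α (u s) z ^ 2) + ∫ x, (1 : ℝ) * u s x ^ 2)
        ≤ ∫ s in Ioc 0 T, ((∫ z, gag α (u s) z ^ 2) + ∫ x, (1 : ℝ) * u s x ^ 2) :=
      setIntegral_mono_set (hAi.add hui) (ae_of_all _ fun s =>
        add_nonneg (integral_nonneg fun z => sq_nonneg _) (hsq (isWeight_one n) (u s)))
        sub.eventuallyLE
    rw [integral_const_mul] at h1
    have h3 := mul_le_mul_of_nonneg_left (h2.trans hYint) (half_pos hμ).le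
    linarith
  have := mul_le_mul_of_nonneg_left hlow hCf.le
  linarith

end Solution

end FracControl

/-! ### The uniform tail estimate. -/

theorem mainTheorem5 (n : ℕ) (α : ℝ) (hα₀ : 0 < α) (hα₁ : α < 1)
    (p lam₁ lam₂ : ℝ) (F : ℝ → FracControl.Rn n → ℝ → ℝ)
    (ψ₁ ψ₂ ψ₃ : ℝ → FracControl.Rn n → ℝ)
    (hF : FracControl.DriftCondition p lam₁ lam₂ F ψ₁ ψ₂ ψ₃)
    (g : ℝ → FracControl.H n)
    (hg : ∀ a b : ℝ, MemLp g 2 (volume.restrict (Icc a b)))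
    (κ : FracControl.Rn n → ℝ)
    (σ₁ : ℝ → Lp FracControl.Ell2 2 (volume : Measure (FracControl.Rn n)))
    (σ₂ : ℕ → ℝ → FracControl.Rn n → ℝ → ℝ) (a b c : ℕ → ℝ)
    (hσ : FracControl.DiffusionCondition κ σ₁ σ₂ a b c)
    (T : ℝ) (hT : 0 < T) (u₀ : FracControl.H n)
    (R : ℝ) (hR : 0 < R) (ε : ℝ) (hε : 0 < ε) :
    ∃ K : ℝ, 0 < K ∧
      ∀ v : FracControl.Control T, ‖v‖ ≤ R →
      ∀ u : ℝ → FracControl.H n,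
        FracControl.IsSolution α p T F g κ σ₁ σ₂ u₀ v u →
      ∀ m : ℝ, K ≤ m → ∀ t ∈ Icc 0 T,
        ∫ x in {x : FracControl.Rn n | m ≤ ‖x‖}, |u t x| ^ 2 < ε := by
  open FracControl Filter Topology in
  obtain ⟨G, hG, hG2⟩ := exists_represents_forcing (T := T)
    ((hg 0 T).mono_measure (Measure.restrict_mono Ioc_subset_Icc_self le_rfl))
  obtain ⟨S₁, hS, hS₁⟩ := exists_joint_representative hσ.sigma₁_cont.stronglyMeasurable
  obtain ⟨B, C, hB, hC, hbound⟩ := hσ.exists_bound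
  obtain ⟨N, hN, hκN⟩ := exists_ae_abs_le_of_memLp_top hσ.kappa_Linf
  -- `κ` is only almost everywhere measurable; a Borel version is needed for the noise to be
  -- measurable on space-time.
  obtain ⟨κ', hκm, hκ⟩ : ∃ κ' : Rn n → ℝ, Measurable κ' ∧ κ' =ᵐ[volume] κ :=
    ⟨_, hσ.kappa_L2.1.stronglyMeasurable_mk.measurable, hσ.kappa_L2.1.ae_eq_mk.symm⟩
  have hnoise : ∀ᵐ x : Rn n, ∀ (τ w : Ell2) (t s : ℝ),
      |∑' k, (τ k + κ' x * σ₂ k t x s) * w k|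
        ≤ (‖τ‖ + B * |κ' x| + N * C * |s|) * ‖w‖ := by
    filter_upwards [hκN, hκ] with x h1 h2 τ w t s
    refine (hbound τ w (κ' x) t x s).trans (mul_le_mul_of_nonneg_right ?_ (norm_nonneg _))
    have : |κ' x| * (C * |s|) ≤ N * (C * |s|) :=
      mul_le_mul_of_nonneg_right (h2 ▸ h1) (by positivity)
    linarith
  obtain ⟨X, hX⟩ := exists_uniform_weighted_bound hα₀ hα₁ hF hσ hκm hκ hS hS₁ hG hG2 hnoise hT.le
    u₀ R
  set W := Real.exp ((1 + (N * C) ^ 2) * T + 2 * R ^ 2) with hW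
  have hW0 : 0 < W := Real.exp_pos _
  -- Makes the commutator error at most `ε/2` after the Grönwall factor `W`, whatever the sign of
  -- `X` and also if `X = 0`.
  set μ : ℝ := ε / (2 * W * (|X| + 1)) with hμ
  have hμ0 : 0 < μ := by positivity
  have hμX : μ * X * W ≤ ε / 2 := by
    have h1 : μ * (|X| + 1) * W = ε / 2 := by
      rw [hμ]
      field_simp
    have h2 : μ * X * W ≤ μ * (|X| + 1) * W := by
      gcongr
      linarith [le_abs_self X]
    linarith
  have hQ := integrable_source (κ' := κ') hF hσ hκ hS hS₁ hG2 B T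
  have t1 : Tendsto (fun m => ∫ x, tailWeight n m x * u₀ x ^ 2) atTop (𝓝 0) :=
    tendsto_integral_tailWeight measurable_id (Lp.memLp u₀).integrable_sq
  have t2 := tendsto_integral_tailWeight measurable_snd hQ
  have t3 := ((t1.add t2).mul_const W)
  rw [add_zero, zero_mul] at t3
  have hev := (t3.eventually (gt_mem_nhds (half_pos hε))).and
    ((tendsto_kernelMass (n := n) hα₀ hα₁).eventually (ge_mem_nhds
      (ENNReal.ofReal_pos.2 (by positivity : 0 < μ ^ 2))))
  -- A single index makes the weighted data times `W` less than `ε/2` and the kernel mass at most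
  -- `μ²`.
  obtain ⟨k, hk1, hk2⟩ := hev.exists
  -- Beyond the radius `k + 1` the tail weight is identically 1.
  refine ⟨(k : ℝ) + 1, by positivity, fun v hv u h m hm t ht => ?_⟩
  have hη := isWeight_tailWeight n k
  have hfin := hX v hv u h _ μ _ hη hμ0 hk2 t ht
  have hint : Integrable fun x => tailWeight n k x * u t x ^ 2 :=
    memLp_one_iff_integrable.1 (hη.memLp_mul measurable_id
      (memLp_one_iff_integrable.2 (Lp.memLp (u t)).integrable_sq))
  have hmeas : MeasurableSet {x : Rn n | m ≤ ‖x‖} := measurableSet_le measurable_const measurable_norm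
  calc ∫ x in {x : Rn n | m ≤ ‖x‖}, |u t x| ^ 2
      = ∫ x in {x : Rn n | m ≤ ‖x‖}, tailWeight n k x * u t x ^ 2 := by
        refine setIntegral_congr_fun hmeas fun x hx => ?_
        simp only [sq_abs]
        rw [tailWeight_eq_one (hm.trans hx), one_mul]
    _ ≤ ∫ x, tailWeight n k x * u t x ^ 2 :=
        setIntegral_le_integral hint (ae_of_all _ fun x => mul_nonneg (hη.nonneg x) (sq_nonneg _))
    _ ≤ _ := hfin
    _ < ε := by
        rw [add_mul]
        linarith
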